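/- **Setting.** Let $N=\mathbf G/\mathbf H$ be a horosymmetric space of a connected complex reductive group $\mathbf G$: there is a parabolic subgroup $\mathbf P\supset \mathbf H$ with Levi subgroup $\mathbf L$ and an involution $\sigma$ of $\mathbf L$ such that $N$ fibres over $\mathbf G/\mathbf P$ with fibre the symmetric space $\mathbf P/\mathbf H$ of $\mathbf L$, and such that the Lie algebra of the unipotent radical of $\mathbf P$ lies in that of $\mathbf H$. Fix a $\sigma$-stable maximal torus with real part $\mathfrak a$ and roots $\Phi\subset\mathfrak a^*$, and positive roots $\Phi_+$ such that the roots of the unipotent radical of $\mathbf P$ are negative and each positive root of $\mathbf L$ is either fixed by $\sigma$ or sent by $\sigma$ to a negative root. Let $\Phi_s^+$ be the set of positive roots of $\mathbf L$ that are not fixed by $\sigma$, let $\Phi_u$ be the set of positive roots that are not roots of $\mathbf L$, and put $$2\rho_u=\sum_{\beta\in\Phi_u}\beta,\qquad 2\rho=\sum_{\alpha\in\Phi_s^+\cup\Phi_u}\alpha .$$ Let $\mathfrak a'=\{x\in\mathfrak a:\sigma x=-x\}$ and let $\mathfrak a'^*\subset\mathfrak a^*$ be the $(-1)$-eigenspace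 of $\sigma$ on $\mathfrak a^*$. Let $\mathfrak a'_+=\{x\in\mathfrak a':\alpha(x)>0\ \forall\alpha\in\Phi_s^+\}$. For $y\in\mathfrak a^*$ and $x\in\mathfrak a'$ put $$\pi_0(y)=\prod_{\alpha\in\Phi_s^+\cup\Phi_u}(\alpha,y),\qquad J_0(x)=\prod_{\alpha\in\Phi_s^+}\sinh\alpha(x),$$ where $(\alpha,y)$ is normalised as the value of $y$ on the coroot $\alpha^\vee$. A $\mathbf K$-invariant Kähler metric on $N$ of horosymmetric form is given by a smooth function $\psi$ on $\mathfrak a'$ that is invariant under the restricted Weyl group and such that $\mathrm{Hess}\,\psi$ is positive definite on $\mathfrak a'$ and, on $\mathfrak a'_+$, $(\alpha,\nabla\psi)/\sinh\alpha(x)>0$ for $\alpha\in\Phi_s^+$ and $e^{-\beta(x)}(\beta,\nabla\psi+2\rho_u)>0$ for $\beta\in\Phi_u$. Its volume is, up to a fixed constant, $\int_{\mathfrak a'_+}\pi_0(\nabla\psi+2\rho_u)\det(\nabla^2\psi)\,dx$. Let $\overline N$ be a $\mathbb Q$-Fano compactification of $N$, embedded $\mathbf G$-equivariantly by the sections of $-lK_{\overline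 N}$, $l\ge 1$. The admissible metric induced by a $\mathbf K$-invariant Fubini–Study metric has potential $\psi_0(x)=\frac1l\log\sum_{\chi\in S}c_\chi e^{\langle\chi,x\rangle}$, $c_\chi>0$, where $S\subset\mathfrak a'^*$ is the finite set of weights of the sections that do not vanish at the base point, translated by $-2l\rho_u$. The moment polytope $P\subset\mathfrak a'^*$ of $\overline N$ is given by $2P=\frac1l\,\mathrm{conv}(S)$. Let $P_+=\{y\in P:(\alpha,y)\ge0\ \forall\alpha\in\Phi_s^+\}$, which is the quotient of $P$ by the restricted Weyl group. For $X\in\mathfrak a'$ put $\theta_X(y)=\langle X,y\rangle$ (an additive constant is immaterial) and $$\mathrm{bar}_X(2P_+)=\frac{\int_{2(P_++\rho_u)}y\,e^{\theta_X(y)}\pi_0(y)\,dy}{\int_{2(P_++\rho_u)}e^{\theta_X(y)}\pi_0(y)\,dy}\in 2\rho_u+\mathfrak a'^*.$$ Let $\Xi\subset\mathfrak a^*$ be the relative interior of the convex cone generated by $\Phi_s^+$ (so $\Xi=\{0\}$ if $\Phi_s^+=\emptyset$). **Lemma.** Let $X\in\mathfrak a'$ and suppose that there is a Kähler–Ricci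 soliton on $N$ with respect to the holomorphic vector field induced by $X$, of the above form, determined by a function $\psi$ that satisfies, for some constant $c>0$, $$\pi_0(\nabla\psi+2\rho_u)\det(\nabla^2\psi)=c\,J_0(x)\,e^{-\psi-X(\psi)}\quad\text{on }\mathfrak a'_+,\qquad X(\psi)=\langle X,\nabla\psi\rangle .$$ Suppose that it has full mass on $\overline N$: $\psi\le\psi_0+C$ for a constant $C$ (it extends to a positive current in the class of the admissible metric), and $\psi$ and $\psi_0$ have the same volume. Then the denominator of $\mathrm{bar}_X(2P_+)$ is positive and $$\mathrm{bar}_X(2P_+)\in 2\rho+\Xi .$$ -/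

import Mathlib

open scoped ContDiff Pointwise RealInnerProductSpace
open MeasureTheory

noncomputable section

/-- The roots of the standard Levi subgroup attached to a set `J` of simple roots. -/
def leviRoots {ι 𝔞 : Type*} [NormedAddCommGroup 𝔞] [InnerProductSpace ℝ 𝔞]
    (R : RootPairing ι ℝ 𝔞 𝔞) (J : Set ι) : Set ι :=
  {i | R.root i ∈ Submodule.span ℝ (R.root '' J)}

/-- The root data `(Φ, Φ₊, Φ_L, σ)` of a horosymmetric space `N = G/H`.  Here `G` is a connected
complex reductive group with maximal torus `T`, `𝔞` is the non-compact part of the Lie algebra of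
`T`, `N` fibres over the flag manifold `G/P` with fibre the symmetric space `P/H` of the Levi
subgroup `L` of `P`, and `σ` is the involution of `L`.  The torus `T ⊆ L` is `σ`-stable and, together
with the positive roots, adapted to `σ` as usual.

The dual `𝔞*` is identified with `𝔞` by an inner product which is invariant under the Weyl group of
`L` and under `σ` (such an inner product always exists, these generate a finite group). -/
structure HorosymmetricDatum (ι 𝔞 : Type*) [Fintype ι] [NormedAddCommGroup 𝔞]
    [InnerProductSpace ℝ 𝔞] where
  /-- The roots `Φ ⊆ 𝔞* = 𝔞` and the coroots in `𝔞`, paired by evaluation. -/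
  R : RootPairing ι ℝ 𝔞 𝔞
  pairing_eq : ∀ y x : 𝔞, R.toLinearMap y x = ⟪y, x⟫
  crystallographic : R.IsCrystallographic
  reduced : R.IsReduced
  /-- The simple roots, which determine `Φ₊`. -/
  base : R.Base
  /-- The simple roots of the Levi subgroup `L`. -/
  leviSimple : Set ι
  leviSimple_subset : leviSimple ⊆ base.support
  /-- The involution on `𝔞` (and on `𝔞*`). -/
  σ : 𝔞 ≃ₗᵢ[ℝ] 𝔞
  σ_involutive : ∀ x, σ (σ x) = x
  /-- The inner product is invariant under the Weyl group of `L`. -/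
  inner_invariant : ∀ i ∈ leviRoots R leviSimple, ∀ x, ‖R.reflection i x‖ = ‖x‖
  /-- `σ` permutes the roots of `L`. -/
  σ_root : ∀ i ∈ leviRoots R leviSimple,
    ∃ j ∈ leviRoots R leviSimple, R.root j = σ (R.root i)
  /-- A positive root of `L` is either fixed by `σ` or mapped to a negative root. -/
  σ_adapted : ∀ i ∈ leviRoots R leviSimple, base.IsPos i → σ (R.root i) ≠ R.root i →
    ∃ j, base.IsPos j ∧ R.root j = -σ (R.root i)

namespace HorosymmetricDatum

variable {ι 𝔞 : Type*} [Fintype ι] [NormedAddCommGroup 𝔞] [InnerProductSpace ℝ 𝔞]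

/-- `Φ_L` -/
def levi (D : HorosymmetricDatum ι 𝔞) : Set ι := leviRoots D.R D.leviSimple

open Classical in
/-- `Φ_s⁺`: the positive roots of `L` that are not fixed by `σ`. -/
def sPos (D : HorosymmetricDatum ι 𝔞) : Finset ι :=
  Finset.univ.filter fun i => D.base.IsPos i ∧ i ∈ D.levi ∧ D.σ (D.R.root i) ≠ D.R.root i

open Classical in
/-- `Φ_u`: the positive roots that are not roots of `L`; the roots of the unipotent radical of `P`
are their negatives. -/
def uPos (D : HorosymmetricDatum ι 𝔞) : Finset ι :=
  Finset.univ.filter fun i => D.base.IsPos i ∧ i ∉ D.levi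

/-- `2ρ_u = ∑_{β ∈ Φ_u} β` -/
def twoRhoU (D : HorosymmetricDatum ι 𝔞) : 𝔞 := ∑ i ∈ D.uPos, D.R.root i

/-- `2ρ = ∑_{α ∈ Φ_s⁺ ∪ Φ_u} α` -/
def twoRho (D : HorosymmetricDatum ι 𝔞) : 𝔞 :=
  ∑ i ∈ D.sPos, D.R.root i + ∑ i ∈ D.uPos, D.R.root i

/-- `Ξ`: the relative interior of the convex cone generated by `Φ_s⁺`. -/
def Xi (D : HorosymmetricDatum ι 𝔞) : Set 𝔞 :=
  intrinsicInterior ℝ (PointedCone.hull ℝ (D.R.root '' (D.sPos : Set ι)) : Set 𝔞)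

/-- `𝔞'`: the `(-1)`-eigenspace of `σ`, which is the real part of `𝔱' ≅ 𝔱 / 𝔱₀`.  Under the
identification `𝔞* = 𝔞` it is also the dual `𝔞'*`, that is, the annihilator of `𝔱₀`.
The point `x ∈ 𝔞'` stands for the point `exp(-x / 2) H` of `N`, where the Lie algebra of `H` contains
the root spaces of the roots `-β`, `β ∈ Φ_u`. -/
def aPrime (D : HorosymmetricDatum ι 𝔞) : Submodule ℝ 𝔞 where
  carrier := {x | D.σ x = -x}
  add_mem' {x y} hx hy := by
    change D.σ x = -x at hx
    change D.σ y = -y at hy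
    change D.σ (x + y) = -(x + y)
    rw [map_add, hx, hy]; abel
  zero_mem' := by simp
  smul_mem' c x hx := by
    change D.σ x = -x at hx
    change D.σ (c • x) = -(c • x)
    rw [map_smul, hx, smul_neg]

/-- The function `π₀(y) = ∏_{α ∈ Φ_s⁺ ∪ Φ_u} (α, y)` on `𝔞*`, where `(α, y)` is normalised as the
value of `y` on the coroot of `α`; for a Weyl-invariant inner product this is
`2 (α, y) / (α, α)`. -/
def piZero (D : HorosymmetricDatum ι 𝔞) (y : 𝔞) : ℝ :=
  (∏ i ∈ D.sPos, ⟪y, D.R.coroot i⟫) * ∏ i ∈ D.uPos, ⟪y, D.R.coroot i⟫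

/-- The cone `𝔞'₊`. -/
def chamber (D : HorosymmetricDatum ι 𝔞) : Set D.aPrime :=
  {x | ∀ i ∈ D.sPos, 0 < ⟪D.R.root i, (x : 𝔞)⟫}

/-- `J₀(x) = ∏_{α ∈ Φ_s⁺} sinh α(x)` -/
def jZero (D : HorosymmetricDatum ι 𝔞) (x : D.aPrime) : ℝ :=
  ∏ i ∈ D.sPos, Real.sinh ⟪D.R.root i, (x : 𝔞)⟫

variable [FiniteDimensional ℝ 𝔞]

/-- The reflection of `𝔞'` in the restriction of the root `α` to `𝔞'`.  For `α ∈ Φ_s⁺` these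
reflections generate the restricted Weyl group. -/
def restrictedReflection (D : HorosymmetricDatum ι 𝔞) (i : ι) : D.aPrime ≃ₗᵢ[ℝ] D.aPrime :=
  (ℝ ∙ D.aPrime.orthogonalProjectionOnto (D.R.root i))ᗮ.reflection

/-- The gradient of a function on `𝔞'`. -/
def grad (D : HorosymmetricDatum ι 𝔞) (ψ : D.aPrime → ℝ) (x : D.aPrime) : D.aPrime :=
  gradient ψ x

/-- The Hessian of a function on `𝔞'`. -/
def hess (D : HorosymmetricDatum ι 𝔞) (ψ : D.aPrime → ℝ) (x : D.aPrime) :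
    D.aPrime →L[ℝ] D.aPrime :=
  fderiv ℝ (D.grad ψ) x

/-- The point `∇ψ(x) + 2ρ_u` of `𝔞*`. -/
def shiftedGrad (D : HorosymmetricDatum ι 𝔞) (ψ : D.aPrime → ℝ) (x : D.aPrime) : 𝔞 :=
  (D.grad ψ x : 𝔞) + D.twoRhoU

/-- `ψ` is the convex potential of a `K`-invariant Kähler metric on `N`: it is smooth and invariant
under the restricted Weyl group, and the block-diagonal Hermitian form with the blocks
`Hess ψ / 4`, `(α, ∇ψ) / (2 sinh α(x))` for `α ∈ Φ_s⁺`, and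
`e^{-β(x)} (β, ∇ψ + 2ρ_u) / 2` for `β ∈ Φ_u` is positive definite. -/
structure IsKahlerPotential (D : HorosymmetricDatum ι 𝔞) (ψ : D.aPrime → ℝ) : Prop where
  smooth : ContDiff ℝ ∞ ψ
  weyl_invariant : ∀ i ∈ D.sPos, ∀ x, ψ (D.restrictedReflection i x) = ψ x
  hess_pos : ∀ x v, v ≠ 0 → 0 < ⟪D.hess ψ x v, v⟫ / 4
  s_pos : ∀ x ∈ D.chamber, ∀ i ∈ D.sPos,
    0 < ⟪(D.grad ψ x : 𝔞), D.R.coroot i⟫ / (2 * Real.sinh ⟪D.R.root i, (x : 𝔞)⟫)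
  u_pos : ∀ x ∈ D.chamber, ∀ i ∈ D.uPos,
    0 < Real.exp (-⟪D.R.root i, (x : 𝔞)⟫) * ⟪D.shiftedGrad ψ x, D.R.coroot i⟫ / 2

/-- The reduced Kähler-Ricci soliton equation
`π₀(∇ψ + 2ρ_u) det(∇²ψ) = J₀ e^{-ψ - X(ψ)}` on the cone `𝔞'₊`, for the holomorphic vector field of
`X ∈ 𝔞'`.  A positive constant `c`, which depends on the normalisation of the inner product and of
the Haar measure, is allowed on the right; it can be absorbed by adding a constant to `ψ`. -/
def ReducedSolitonEquation (D : HorosymmetricDatum ι 𝔞) (X : D.aPrime) (ψ : D.aPrime → ℝ) : Prop :=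
  ∃ c : ℝ, 0 < c ∧ ∀ x ∈ D.chamber,
    D.piZero (D.shiftedGrad ψ x) * (D.hess ψ x).det =
      c * (D.jZero x * Real.exp (-ψ x - ⟪X, D.grad ψ x⟫))

/-- A projective compactification of `N`, embedded `G`-equivariantly by the sections of a power
`-l K`, with a `K`-invariant Fubini-Study metric, seen on the torus orbit of the base point.
Let `v` be a vector over the base point.  The `T`-weights of the sections that do not vanish at the
base point lie in `2 l ρ_u + 𝔞'*`, because the isotropy group acts on the anticanonical fibre there
through `2ρ_u`.  `weights` is the set of these weights, translated by `-2 l ρ_u`, and `coeff` gives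
the squared norms of the components of `v`.  So `(1 / l) log ‖exp(-x / 2) v‖²` is, up to the linear
function `2ρ_u`, the function in `kahler`, and this is the potential of a Kähler metric on `N`. -/
structure Compactification (D : HorosymmetricDatum ι 𝔞) where
  level : ℕ
  level_pos : 0 < level
  weights : Finset D.aPrime
  weights_nonempty : weights.Nonempty
  coeff : D.aPrime → ℝ
  coeff_pos : ∀ χ ∈ weights, 0 < coeff χ
  kahler : D.IsKahlerPotential fun x =>
    (level : ℝ)⁻¹ * Real.log (∑ χ ∈ weights, coeff χ * Real.exp ⟪χ, x⟫)

namespace Compactification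

variable {D : HorosymmetricDatum ι 𝔞}

/-- The potential of the admissible metric induced by the Fubini-Study metric. -/
def admissiblePotential (M : D.Compactification) (x : D.aPrime) : ℝ :=
  (M.level : ℝ)⁻¹ * Real.log (∑ χ ∈ M.weights, M.coeff χ * Real.exp ⟪χ, x⟫)

/-- The moment polytope `P ⊆ 𝔞'*`; it is normalised so that `2P` is the convex hull of the (translated)
weights, divided by `l`. -/
def momentPolytope (M : D.Compactification) : Set D.aPrime :=
  (2 * (M.level : ℝ))⁻¹ • convexHull ℝ (M.weights : Set D.aPrime)

/-- `P₊`: the part of `P` in the closed restricted Weyl chamber, a fundamental domain for the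
restricted Weyl group. -/
def dominantPart (M : D.Compactification) : Set D.aPrime :=
  {y | y ∈ M.momentPolytope ∧ ∀ i ∈ D.sPos, 0 ≤ ⟪(y : 𝔞), D.R.coroot i⟫}

end Compactification

variable [MeasurableSpace 𝔞] [BorelSpace 𝔞]

/-- `∫_N ω_ψ^n = ∫_{𝔞'₊} π₀(∇ψ + 2ρ_u) det(∇²ψ) dx`, up to a constant depending only on `N`. -/
def metricVolume (D : HorosymmetricDatum ι 𝔞) (ψ : D.aPrime → ℝ) : ℝ :=
  ∫ x in D.chamber, D.piZero (D.shiftedGrad ψ x) * (D.hess ψ x).det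

namespace Compactification

variable {D : HorosymmetricDatum ι 𝔞}

/-- The metric with potential `ψ` on `N` has full mass on the compactification: it extends to a
positive current in the class of the admissible metric (its potential relative to the admissible
metric is bounded from above), and its volume on `N` is the volume of the admissible metric. -/
structure HasFullMass (M : D.Compactification) (ψ : D.aPrime → ℝ) : Prop where
  current : ∃ C : ℝ, ∀ x, ψ x ≤ M.admissiblePotential x + C
  volume_eq : D.metricVolume ψ = D.metricVolume M.admissiblePotential

/-- The total weight `∫_{2(P₊ + ρ_u)} e^{θ_X(y)} π₀(y) dy`, where `θ_X(y) = ⟨X, y⟩`.  The domain lies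
in the affine subspace `2ρ_u + 𝔞'*` of `𝔞*` and is parametrised by `y = z + 2ρ_u`, `z ∈ 2P₊`. -/
def weightedVolume (M : D.Compactification) (X : D.aPrime) : ℝ :=
  ∫ z in (2 : ℝ) • M.dominantPart,
    Real.exp ⟪(X : 𝔞), (z : 𝔞) + D.twoRhoU⟫ * D.piZero ((z : 𝔞) + D.twoRhoU)

/-- The barycenter `bar_X(2P₊)` of `2(P₊ + ρ_u)` with respect to `e^{θ_X(y)} π₀(y) dy`.  An additive
constant in `θ_X` does not change it. -/
def barycenter (M : D.Compactification) (X : D.aPrime) : 𝔞 :=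
  (M.weightedVolume X)⁻¹ •
    ∫ z in (2 : ℝ) • M.dominantPart,
      (Real.exp ⟪(X : 𝔞), (z : 𝔞) + D.twoRhoU⟫ * D.piZero ((z : 𝔞) + D.twoRhoU)) •
        ((z : 𝔞) + D.twoRhoU)

end Compactification

end HorosymmetricDatum

end

/-!
Write `E` for `𝔞'`, `C` for the chamber and `α'` for the restriction of a root `α` to `E`.

The gradient of a Kähler potential is injective, with Jacobian `det Hess > 0`, so an integral of
`f (∇ψ) det (Hess ψ)` over `C` is the integral of `f` over `∇ψ(C)`.  A potential bounded above by
`ψ₀ + const` has all its gradients in `2P` (`gradient_mem_smul_convexHull`), and on `C` the positivity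
of the metric places them in `2P₊`.  For `ψ₀` itself they fill `2P₊` up to a null set: `ψ₀ - ⟨z, ·⟩` has a
minimum for each `z` in the interior of `2P` (`exists_gradient_logSumExp_eq`), and by invariance under
the restricted Weyl group and strict monotonicity of the gradient a dominant regular gradient is taken
in `C`.  As `π₀ > 0` almost everywhere on the shifted polytope, where the invariance of `2ρ_u` under
the Weyl group of `L` enters, equality of the volumes forces `∇ψ(C) = 2P₊` up to a null set
(`image_grad_ae_eq`).

The soliton equation therefore turns the weighted integrals over `2P₊` into integrals over `C` against
`J₀ e^{-ψ}`; in particular `J₀ e^{-ψ}` is integrable and the barycenter is `2ρ_u` plus the mean of `∇ψ`.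
Integration by parts (`setIntegral_smul_gradient`) gives
`∫_C J₀ e^{-ψ} ∇ψ = ∫_C e^{-ψ} ∇J₀ = ∑_{α ∈ Φ_s⁺} (∫_C coth(α) J₀ e^{-ψ}) α'`.
No decay of `ψ` is assumed; instead the translates of `J₀ e^{-ψ}`, extended by zero, in directions
`v ∈ C` are compared.  Their integral is constant, `∇ψ` is bounded, and `t ↦ J₀(x + t v)` is convex, which
provides the domination needed to differentiate under the integral and the integrability of the
right-hand side.

Since `coth > 1`, the barycenter is `2ρ_u + ∑ (1 + k_α) α'` with all `k_α > 0`.  The involution `-σ`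
permutes `Φ_s⁺`, and `α' = (α - σα) / 2`, so `∑ α' = ∑ α` and the rest is a combination of the elements of
`Φ_s⁺` with positive coefficients, that is, a point of the relative interior of their cone
(`sum_smul_mem_intrinsicInterior_hull`).
-/

/-! ### Potentials with positive definite Hessian -/

section ConvexPotential

variable {E : Type*} [NormedAddCommGroup E] [InnerProductSpace ℝ E] [FiniteDimensional ℝ E]
  {ψ : E → ℝ}

lemma contDiff_gradient (hψ : ContDiff ℝ ∞ ψ) : ContDiff ℝ ∞ (gradient ψ) := by
  have h : ContDiff ℝ ∞ (fderiv ℝ ψ) := hψ.fderiv_right (by simp)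
  exact (InnerProductSpace.toDual ℝ E).symm.contDiff.comp h

lemma abs_sub_le_of_norm_gradient_le (hψ : Differentiable ℝ ψ) {L : ℝ}
    (hL : ∀ x, ‖gradient ψ x‖ ≤ L) (x y : E) : |ψ x - ψ y| ≤ L * ‖x - y‖ := by
  refine Convex.norm_image_sub_le_of_norm_fderiv_le (𝕜 := ℝ) (fun z _ => hψ z) (fun z _ => ?_)
    convex_univ (Set.mem_univ y) (Set.mem_univ x)
  rw [← toDual_gradient, LinearIsometryEquiv.norm_map]
  exact hL z

lemma hasDerivAt_comp_line (hψ : ContDiff ℝ ∞ ψ) (x v : E) (t : ℝ) :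
    HasDerivAt (fun t : ℝ => ψ (x + t • v)) ⟪gradient ψ (x + t • v), v⟫ t := by
  have h1 : HasDerivAt (fun t : ℝ => x + t • v) v t := by
    simpa using ((hasDerivAt_id t).smul_const v).const_add x
  have h2 := (hψ.differentiable (by simp) (x + t • v)).hasFDerivAt.comp_hasDerivAt t h1
  rwa [← inner_gradient_left] at h2

lemma hasDerivAt_inner_gradient_line (hψ : ContDiff ℝ ∞ ψ) (x v : E) (t : ℝ) :
    HasDerivAt (fun t : ℝ => ⟪gradient ψ (x + t • v), v⟫)
      ⟪fderiv ℝ (gradient ψ) (x + t • v) v, v⟫ t := by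
  have h1 : HasDerivAt (fun t : ℝ => x + t • v) v t := by
    simpa using ((hasDerivAt_id t).smul_const v).const_add x
  have h2 := ((contDiff_gradient hψ).differentiable (by simp)
    (x + t • v)).hasFDerivAt.comp_hasDerivAt t h1
  simpa using h2.inner ℝ (hasDerivAt_const t v)

lemma strictMono_inner_gradient_line (hψ : ContDiff ℝ ∞ ψ)
    (hpos : ∀ x v, v ≠ 0 → 0 < ⟪fderiv ℝ (gradient ψ) x v, v⟫) (x : E) {v : E} (hv : v ≠ 0) :
    StrictMono (fun t : ℝ => ⟪gradient ψ (x + t • v), v⟫) :=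
  strictMono_of_deriv_pos fun t => by
    rw [(hasDerivAt_inner_gradient_line hψ x v t).deriv]
    exact hpos _ _ hv

lemma inner_gradient_sub_pos (hψ : ContDiff ℝ ∞ ψ)
    (hpos : ∀ x v, v ≠ 0 → 0 < ⟪fderiv ℝ (gradient ψ) x v, v⟫) {x y : E} (hxy : x ≠ y) :
    0 < ⟪gradient ψ y - gradient ψ x, y - x⟫ := by
  have h := strictMono_inner_gradient_line hψ hpos x (sub_ne_zero.2 hxy.symm) zero_lt_one
  rw [inner_sub_left, sub_pos]
  simpa using h

lemma gradient_injective (hψ : ContDiff ℝ ∞ ψ)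
    (hpos : ∀ x v, v ≠ 0 → 0 < ⟪fderiv ℝ (gradient ψ) x v, v⟫) :
    Function.Injective (gradient ψ) := by
  intro x y h
  by_contra hxy
  have := inner_gradient_sub_pos hψ hpos hxy
  simp [h] at this

/-- A function with positive definite Hessian lies above its tangent planes. -/
lemma add_inner_gradient_le (hψ : ContDiff ℝ ∞ ψ)
    (hpos : ∀ x v, v ≠ 0 → 0 < ⟪fderiv ℝ (gradient ψ) x v, v⟫) (x y : E) :
    ψ x + ⟪gradient ψ x, y - x⟫ ≤ ψ y := by
  rcases eq_or_ne x y with rfl | hxy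
  · simp
  have hd := hasDerivAt_comp_line hψ x (y - x)
  obtain ⟨s, hs, h⟩ := exists_hasDerivAt_eq_slope (fun t : ℝ => ψ (x + t • (y - x)))
    (fun t => ⟪gradient ψ (x + t • (y - x)), y - x⟫) zero_lt_one
    (fun t _ => (hd t).continuousAt.continuousWithinAt) (fun t _ => hd t)
  have h2 := strictMono_inner_gradient_line hψ hpos x (sub_ne_zero.2 hxy.symm) hs.1
  simp only [zero_smul, add_zero, one_smul, add_sub_cancel, sub_zero, div_one] at h h2
  linarith

/-- A linear map with positive definite quadratic form can be joined to the identity by such maps,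
so its determinant is positive. -/
lemma det_pos_of_inner_pos (A : E →L[ℝ] E) (hA : ∀ v, v ≠ 0 → 0 < ⟪A v, v⟫) : 0 < A.det := by
  let B : ℝ → E →L[ℝ] E := fun t => (1 - t) • ContinuousLinearMap.id ℝ E + t • A
  have hcont : Continuous fun t => (B t).det :=
    ContinuousLinearMap.continuous_det.comp (by fun_prop)
  have hne : ∀ t ∈ Set.Icc (0 : ℝ) 1, (B t).det ≠ 0 := by
    intro t ht h0
    have hbot : (B t : E →ₗ[ℝ] E).ker ≠ ⊥ := (LinearMap.bot_lt_ker_of_det_eq_zero h0).ne'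
    obtain ⟨v, hv, hv0⟩ := (Submodule.ne_bot_iff _).1 hbot
    have hBv : B t v = 0 := hv
    have h1 : ⟪B t v, v⟫ = (1 - t) * ⟪v, v⟫ + t * ⟪A v, v⟫ := by
      simp [B, inner_add_left, real_inner_smul_left]
    have h2 : 0 < ⟪v, v⟫ := real_inner_self_pos.2 hv0
    have h3 := hA v hv0
    rw [hBv, inner_zero_left] at h1
    rcases eq_or_lt_of_le ht.1 with h | h
    · rw [← h] at h1; linarith
    · nlinarith [mul_pos h h3, mul_nonneg (sub_nonneg.2 ht.2) h2.le]
  have h0 : (B 0).det = 1 := by simp [B, ContinuousLinearMap.det]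
  have h1 : B 1 = A := by simp [B]
  by_contra hneg
  obtain ⟨t, ht, h⟩ := intermediate_value_Icc' zero_le_one hcont.continuousOn
    (show (0 : ℝ) ∈ Set.Icc (B 1).det (B 0).det from ⟨by rw [h1]; exact not_lt.1 hneg, by
      rw [h0]; exact zero_le_one⟩)
  exact hne t ht h

end ConvexPotential

/-! ### Log-sum-exp functions and their gradients -/

section LogSumExp

variable {E : Type*} [NormedAddCommGroup E] [InnerProductSpace ℝ E]

/-- The function `l⁻¹ log ∑ c_χ e^{⟨χ, x⟩}`, a smoothing of the support function of the convex hull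
of `W`, divided by `l`. -/
noncomputable def logSumExp (l : ℝ) (W : Finset E) (c : E → ℝ) (x : E) : ℝ :=
  l⁻¹ * Real.log (∑ χ ∈ W, c χ * Real.exp ⟪χ, x⟫)

variable {l : ℝ} {W : Finset E} {c : E → ℝ}

lemma logSumExp_le (hl : 0 < l) (hW : W.Nonempty) (hc : ∀ χ ∈ W, 0 < c χ) {x : E} {u : ℝ}
    (hx : ∀ χ ∈ W, ⟪χ, x⟫ ≤ l * u) :
    logSumExp l W c x ≤ u + l⁻¹ * Real.log (∑ χ ∈ W, c χ) := by
  have hs : 0 < ∑ χ ∈ W, c χ := Finset.sum_pos hc hW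
  have h1 : ∑ χ ∈ W, c χ * Real.exp ⟪χ, x⟫ ≤ Real.exp (l * u) * ∑ χ ∈ W, c χ := by
    rw [mul_comm, Finset.sum_mul]
    exact Finset.sum_le_sum fun χ h =>
      mul_le_mul_of_nonneg_left (Real.exp_le_exp.2 (hx χ h)) (hc χ h).le
  have h2 : Real.log (∑ χ ∈ W, c χ * Real.exp ⟪χ, x⟫) ≤ l * u + Real.log (∑ χ ∈ W, c χ) := by
    refine (Real.log_le_log
      (Finset.sum_pos (fun χ h => mul_pos (hc χ h) (Real.exp_pos _)) hW) h1).trans ?_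
    rw [Real.log_mul (Real.exp_pos _).ne' hs.ne', Real.log_exp]
  calc logSumExp l W c x ≤ l⁻¹ * (l * u + Real.log (∑ χ ∈ W, c χ)) :=
        mul_le_mul_of_nonneg_left h2 (inv_pos.2 hl).le
    _ = _ := by field_simp

lemma isCompact_smul_convexHull (l : ℝ) (W : Finset E) :
    IsCompact (l⁻¹ • convexHull ℝ (W : Set E)) :=
  (W.finite_toSet.isCompact_convexHull ℝ).smul _

lemma convex_smul_convexHull (l : ℝ) (W : Finset E) :
    Convex ℝ (l⁻¹ • convexHull ℝ (W : Set E)) :=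
  (convex_convexHull ℝ _).smul _

lemma exists_inner_le_of_mem_smul_convexHull (hl : 0 < l) {y : E}
    (hy : y ∈ l⁻¹ • convexHull ℝ (W : Set E)) (x : E) : ∃ χ ∈ W, ⟪y, x⟫ ≤ l⁻¹ * ⟪χ, x⟫ := by
  obtain ⟨y, hyW, rfl⟩ := Set.mem_smul_set.1 hy
  have hconv : ConvexOn ℝ (convexHull ℝ (W : Set E)) fun y => ⟪y, x⟫ := by
    simp only [real_inner_comm x]
    exact (innerₗ E x).convexOn (convex_convexHull ℝ (W : Set E))
  obtain ⟨χ, hχ, h⟩ := hconv.exists_ge_of_mem_convexHull (subset_convexHull ℝ _) hyW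
  refine ⟨χ, hχ, ?_⟩
  rw [real_inner_smul_left]
  exact mul_le_mul_of_nonneg_left h (inv_pos.2 hl).le

lemma exists_add_inner_le_logSumExp (hl : 0 < l) (hc : ∀ χ ∈ W, 0 < c χ) (hW : W.Nonempty) :
    ∃ m : ℝ, ∀ y ∈ l⁻¹ • convexHull ℝ (W : Set E), ∀ x, m + ⟪y, x⟫ ≤ logSumExp l W c x := by
  refine ⟨W.inf' hW fun χ => l⁻¹ * Real.log (c χ), fun y hy x => ?_⟩
  obtain ⟨χ, hχ, h⟩ := exists_inner_le_of_mem_smul_convexHull hl hy x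
  have h1 := Finset.inf'_le (fun χ => l⁻¹ * Real.log (c χ)) hχ
  have h2 : Real.log (c χ) + ⟪χ, x⟫ ≤ Real.log (∑ χ ∈ W, c χ * Real.exp ⟪χ, x⟫) := by
    rw [← Real.log_exp ⟪χ, x⟫, ← Real.log_mul (hc χ hχ).ne' (Real.exp_pos _).ne']
    exact Real.log_le_log (mul_pos (hc χ hχ) (Real.exp_pos _))
      (Finset.single_le_sum (f := fun χ => c χ * Real.exp ⟪χ, x⟫)
        (fun χ h => (mul_pos (hc χ h) (Real.exp_pos _)).le) hχ)
  have h3 := mul_le_mul_of_nonneg_left h2 (inv_pos.2 hl).le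
  rw [mul_add] at h3
  unfold logSumExp
  linarith

variable [FiniteDimensional ℝ E]

/-- A convex potential that is bounded above by `logSumExp + C` has its gradients in the polytope:
otherwise, along a ray in the direction of a separating linear form, its tangent plane would
overtake the bound. -/
lemma gradient_mem_smul_convexHull {ψ : E → ℝ} (hψ : ContDiff ℝ ∞ ψ)
    (hpos : ∀ x v, v ≠ 0 → 0 < ⟪fderiv ℝ (gradient ψ) x v, v⟫)
    (hl : 0 < l) (hW : W.Nonempty) (hc : ∀ χ ∈ W, 0 < c χ) {C : ℝ}
    (hle : ∀ x, ψ x ≤ logSumExp l W c x + C) (x : E) :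
    gradient ψ x ∈ l⁻¹ • convexHull ℝ (W : Set E) := by
  by_contra hx
  obtain ⟨f, u, hf, hu⟩ := geometric_hahn_banach_closed_point (convex_smul_convexHull l W)
    (isCompact_smul_convexHull l W).isClosed hx
  set v := (InnerProductSpace.toDual ℝ E).symm f with hv
  have hfv : ∀ y, f y = ⟪y, v⟫ := fun y => by
    rw [real_inner_comm, hv, InnerProductSpace.toDual_symm_apply]
  have hχ : ∀ χ ∈ W, ⟪χ, v⟫ ≤ l * u := fun χ hχ => by
    have := hf (l⁻¹ • χ) (Set.smul_mem_smul_set (subset_convexHull ℝ _ hχ))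
    rw [hfv, real_inner_smul_left, inv_mul_lt_iff₀ hl] at this
    exact this.le
  have hd : 0 < ⟪gradient ψ x, v⟫ - u := by rw [← hfv]; linarith
  set B := l⁻¹ * Real.log (∑ χ ∈ W, c χ) + C - ψ x + ⟪gradient ψ x, x⟫
  have key : ∀ t : ℝ, 0 ≤ t → t * (⟪gradient ψ x, v⟫ - u) ≤ B := fun t ht => by
    have h1 := add_inner_gradient_le hψ hpos x (t • v)
    have h2 := hle (t • v)
    have h3 : logSumExp l W c (t • v) ≤ t * u + _ := logSumExp_le hl hW hc fun χ h => by
      rw [real_inner_smul_right]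
      calc _ ≤ t * (l * u) := mul_le_mul_of_nonneg_left (hχ χ h) ht
        _ = _ := by ring
    rw [inner_sub_right, real_inner_smul_right] at h1
    simp only [B]
    linarith
  have h0 : 0 ≤ B := by simpa using key 0 le_rfl
  have := key ((B + 1) / (⟪gradient ψ x, v⟫ - u)) (by positivity)
  rw [div_mul_cancel₀ _ hd.ne'] at this
  linarith

/-- For `z` in the interior of the polytope, `logSumExp - ⟨z, ·⟩` grows linearly, hence has a minimum,
where the gradient of `logSumExp` is `z`. -/
lemma exists_gradient_logSumExp_eq (hl : 0 < l) (hW : W.Nonempty) (hc : ∀ χ ∈ W, 0 < c χ)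
    (hd : Differentiable ℝ (logSumExp l W c)) {z : E}
    (hz : z ∈ interior (l⁻¹ • convexHull ℝ (W : Set E))) :
    ∃ x, gradient (logSumExp l W c) x = z := by
  obtain ⟨m, hm⟩ := exists_add_inner_le_logSumExp hl hc hW
  obtain ⟨ε, hε, hball⟩ := Metric.nhds_basis_closedBall.mem_iff.1 (mem_interior_iff_mem_nhds.1 hz)
  let f : E → ℝ := fun x => logSumExp l W c x - ⟪z, x⟫
  have hlow : ∀ x, m + ε * ‖x‖ ≤ f x := fun x => by
    have hy : z + (ε * ‖x‖⁻¹) • x ∈ Metric.closedBall z ε := by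
      rw [mem_closedBall_iff_norm, add_sub_cancel_left, norm_smul, norm_mul, norm_inv, norm_norm,
        Real.norm_of_nonneg hε.le, mul_assoc]
      exact mul_le_of_le_one_right hε.le inv_mul_le_one
    have h := hm _ (hball hy) x
    have h2 : ε * ‖x‖⁻¹ * (‖x‖ * ‖x‖) = ε * ‖x‖ := by
      rcases eq_or_ne ‖x‖ 0 with h0 | h0
      · simp [h0]
      · field_simp
    rw [inner_add_left, real_inner_smul_left, real_inner_self_eq_norm_mul_norm, h2] at h
    simp only [f]
    linarith
  have htend : Filter.Tendsto f (Filter.cocompact E) Filter.atTop :=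
    Filter.tendsto_atTop_mono hlow (Filter.tendsto_atTop_add_const_left _ _
      ((tendsto_norm_cocompact_atTop (E := E)).const_mul_atTop hε))
  have hfc : Continuous f := hd.continuous.sub (by fun_prop)
  obtain ⟨x, hx⟩ := hfc.exists_forall_le htend
  refine ⟨x, ext_inner_right ℝ fun v => ?_⟩
  have h0 : fderiv ℝ f x = 0 := IsLocalMin.fderiv_eq_zero (Filter.Eventually.of_forall hx)
  have h1 : HasFDerivAt f (fderiv ℝ (logSumExp l W c) x - innerSL ℝ z) x :=
    (hd x).hasFDerivAt.sub (innerSL ℝ z).hasFDerivAt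
  have h2 : (fderiv ℝ (logSumExp l W c) x - innerSL ℝ z) v = 0 := by rw [← h1.fderiv, h0]; rfl
  rw [inner_gradient_left]
  simpa [sub_eq_zero] using h2

end LogSumExp

/-! ### Integration by parts on a polyhedral cone -/

section SinhProduct

lemma convexOn_sinh_max : ConvexOn ℝ Set.univ fun p : ℝ => Real.sinh (max p 0) := by
  have h1 : ConvexOn ℝ (Set.Ici 0) Real.sinh := by
    refine MonotoneOn.convexOn_of_deriv (convex_Ici 0) Real.continuous_sinh.continuousOn
      Real.differentiable_sinh.differentiableOn ?_
    rw [Real.deriv_sinh]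
    intro x hx y hy hxy
    simp only [interior_Ici, Set.mem_Ioi] at hx hy
    exact Real.cosh_le_cosh.2 (by rwa [abs_of_pos hx, abs_of_pos hy])
  have h2 : ConvexOn ℝ Set.univ fun p : ℝ => max p 0 :=
    (convexOn_id (convex_univ (𝕜 := ℝ) (E := ℝ))).sup (convexOn_const 0 convex_univ)
  have himg : (fun p : ℝ => max p 0) '' Set.univ ⊆ Set.Ici 0 := by
    rintro _ ⟨p, -, rfl⟩; exact Set.mem_Ici.2 (le_max_right _ _)
  have himg' : (fun p : ℝ => max p 0) '' Set.univ = Set.Ici 0 :=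
    himg.antisymm fun p hp => ⟨p, trivial, max_eq_left hp⟩
  exact ConvexOn.comp (g := Real.sinh) (f := fun p : ℝ => max p 0) (by rwa [himg']) h2
    (Real.sinh_strictMono.monotone.monotoneOn _)

variable {ι E : Type*} [NormedAddCommGroup E] [InnerProductSpace ℝ E]

/-- The extension by zero of `∏ sinh ⟨a_i, x⟩` from the cone where all `⟨a_i, x⟩` are positive. -/
noncomputable def sinhProd (s : Finset ι) (a : ι → E) (x : E) : ℝ :=
  ∏ i ∈ s, Real.sinh (max ⟪a i, x⟫ 0)

/-- The cone where all `⟨a_i, x⟩` are positive. -/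
def openCone (s : Finset ι) (a : ι → E) : Set E := {x | ∀ i ∈ s, 0 < ⟪a i, x⟫}

variable {s : Finset ι} {a : ι → E}

lemma isOpen_openCone : IsOpen (openCone s a) := by
  have : openCone s a = ⋂ i ∈ s, {x | 0 < ⟪a i, x⟫} := by ext; simp [openCone]
  rw [this]
  exact isOpen_biInter_finset fun i _ => isOpen_lt continuous_const (by fun_prop)

lemma sinhProd_nonneg (x : E) : 0 ≤ sinhProd s a x :=
  Finset.prod_nonneg fun _ _ => Real.sinh_nonneg_iff.2 (le_max_right _ _)

lemma sinhProd_of_mem {x : E} (hx : x ∈ openCone s a) :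
    sinhProd s a x = ∏ i ∈ s, Real.sinh ⟪a i, x⟫ :=
  Finset.prod_congr rfl fun i hi => by rw [max_eq_left (hx i hi).le]

lemma sinhProd_of_notMem {x : E} (hx : x ∉ openCone s a) : sinhProd s a x = 0 := by
  simp only [openCone, Set.mem_ofPred_eq, not_forall, not_lt] at hx
  obtain ⟨i, hi, h⟩ := hx
  exact Finset.prod_eq_zero hi (by rw [max_eq_right h, Real.sinh_zero])

lemma convexOn_and_monotone_sinhProd_line (s : Finset ι) {v : E} (hv : ∀ i ∈ s, 0 < ⟪a i, v⟫) (x : E) :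
    ConvexOn ℝ Set.univ (fun t : ℝ => sinhProd s a (x + t • v)) ∧
      Monotone fun t : ℝ => sinhProd s a (x + t • v) := by
  classical
  induction s using Finset.induction_on with
  | empty => simpa [sinhProd] using ⟨convexOn_const 1 convex_univ, monotone_const⟩
  | insert i s hi ih =>
    obtain ⟨hconv, hmono⟩ := ih fun j hj => hv j (Finset.mem_insert_of_mem hj)
    have heq : (fun t : ℝ => sinhProd (insert i s) a (x + t • v)) =
        (fun t : ℝ => Real.sinh (max ⟪a i, x + t • v⟫ 0)) *
          fun t : ℝ => sinhProd s a (x + t • v) := by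
      ext t; exact Finset.prod_insert hi
    have hm : Monotone fun t : ℝ => Real.sinh (max ⟪a i, x + t • v⟫ 0) := fun t u htu => by
      refine Real.sinh_le_sinh.2 (max_le_max_right 0 ?_)
      simp only [inner_add_right, real_inner_smul_right]
      have := mul_le_mul_of_nonneg_right htu (hv i (Finset.mem_insert_self i s)).le
      linarith
    have hc : ConvexOn ℝ Set.univ fun t : ℝ => Real.sinh (max ⟪a i, x + t • v⟫ 0) := by
      have := convexOn_sinh_max.comp_affineMap
        (AffineMap.lineMap (k := ℝ) ⟪a i, x⟫ (⟪a i, x⟫ + ⟪a i, v⟫))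
      refine this.congr fun t _ => ?_
      simp [AffineMap.lineMap_apply, inner_add_right, real_inner_smul_right, add_comm]
    have h0 : ∀ t : ℝ, 0 ≤ Real.sinh (max ⟪a i, x + t • v⟫ 0) := fun t =>
      Real.sinh_nonneg_iff.2 (le_max_right _ _)
    rw [heq]
    exact ⟨hc.mul hconv (fun t _ => h0 t) (fun t _ => sinhProd_nonneg _)
      ((hm.monovary hmono).monovaryOn _), fun t u htu =>
        mul_le_mul (hm htu) (hmono htu) (sinhProd_nonneg _) (h0 u)⟩

/-- Along a direction of the cone `sinhProd` is a product of nonnegative increasing convex functions,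
hence convex, and its difference quotients are bounded by the one of step `1`. -/
lemma sinhProd_slope_le {v : E} (hv : v ∈ openCone s a) (x : E) {t : ℝ} (ht : 0 < t)
    (ht1 : t ≤ 1) :
    t⁻¹ * (sinhProd s a (x + t • v) - sinhProd s a x) ≤ sinhProd s a (x + v) - sinhProd s a x := by
  have h := (convexOn_and_monotone_sinhProd_line s hv x).1.2 (Set.mem_univ 0) (Set.mem_univ 1)
    (sub_nonneg.2 ht1) ht.le (by ring)
  simp only [smul_eq_mul, mul_zero, mul_one, zero_add, zero_smul, one_smul, add_zero] at h
  rw [inv_mul_le_iff₀ ht]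
  linarith

lemma sinhProd_le_add {v : E} (hv : v ∈ openCone s a) (x : E) {t : ℝ} (ht : 0 ≤ t) :
    sinhProd s a x ≤ sinhProd s a (x + t • v) := by
  simpa using (convexOn_and_monotone_sinhProd_line s hv x).2 ht

/-- The coefficient of `a_i` in the gradient of `∏ sinh ⟨a_i, x⟩`. -/
noncomputable def sinhProdCoeff [DecidableEq ι] (s : Finset ι) (a : ι → E) (i : ι) (x : E) : ℝ :=
  (∏ j ∈ s.erase i, Real.sinh ⟪a j, x⟫) * Real.cosh ⟪a i, x⟫

lemma continuous_sinhProdCoeff [DecidableEq ι] (i : ι) : Continuous (sinhProdCoeff s a i) :=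
  (continuous_finsetProd _ fun i _ => Real.continuous_sinh.comp (by fun_prop)).mul
    (Real.continuous_cosh.comp (by fun_prop))

lemma sinhProd_lt_sinhProdCoeff [DecidableEq ι] {x : E} (hx : x ∈ openCone s a) {i : ι}
    (hi : i ∈ s) : sinhProd s a x < sinhProdCoeff s a i x := by
  rw [sinhProd_of_mem hx, ← Finset.prod_erase_mul _ _ hi]
  exact mul_lt_mul_of_pos_left (Real.sinh_lt_cosh _)
    (Finset.prod_pos fun j hj => Real.sinh_pos_iff.2 (hx j (Finset.mem_of_mem_erase hj)))

lemma hasDerivAt_sinhProd [DecidableEq ι] {x : E} (hx : x ∈ openCone s a) (v : E) :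
    HasDerivAt (fun t : ℝ => sinhProd s a (x + t • v))
      (∑ i ∈ s, ⟪a i, v⟫ * sinhProdCoeff s a i x) 0 := by
  have h1 : HasDerivAt (fun t : ℝ => ∏ i ∈ s, Real.sinh ⟪a i, x + t • v⟫)
      (∑ i ∈ s, ⟪a i, v⟫ * sinhProdCoeff s a i x) 0 := by
    have hi : ∀ i ∈ s, HasDerivAt (fun t : ℝ => Real.sinh ⟪a i, x + t • v⟫)
        (Real.cosh ⟪a i, x⟫ * ⟪a i, v⟫) 0 := fun i _ => by
      have hl : HasDerivAt (fun t : ℝ => ⟪a i, x + t • v⟫) ⟪a i, v⟫ 0 := by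
        simp only [inner_add_right, real_inner_smul_right]
        simpa using ((hasDerivAt_id (0 : ℝ)).mul_const ⟪a i, v⟫).const_add ⟪a i, x⟫
      simpa using hl.sinh
    refine (HasDerivAt.fun_finsetProd hi).congr_deriv (Finset.sum_congr rfl fun i _ => ?_)
    simp [sinhProdCoeff]
    ring
  refine h1.congr_of_eventuallyEq ?_
  have hc : ContinuousAt (fun t : ℝ => x + t • v) 0 := by fun_prop
  filter_upwards [hc.eventually_mem (isOpen_openCone.mem_nhds (by simpa using hx))] with t ht
  exact sinhProd_of_mem ht

end SinhProduct

section IntegrationByParts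

variable {ι E : Type*} [NormedAddCommGroup E] [InnerProductSpace ℝ E]
  [MeasurableSpace E] [BorelSpace E] {μ : Measure E} [μ.IsAddHaarMeasure]
  {s : Finset ι} {a : ι → E} {ψ : E → ℝ}

open Filter Topology

lemma abs_one_sub_exp_le {u b : ℝ} (hu : |u| ≤ b) : |1 - Real.exp u| ≤ b * Real.exp b := by
  have h1 := Real.add_one_le_exp u
  have h2 := Real.add_one_le_exp (-u)
  obtain ⟨h3, h4⟩ := abs_le.1 hu
  have hb : 0 ≤ b := (abs_nonneg u).trans hu
  have he : 1 ≤ Real.exp b := Real.one_le_exp hb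
  have h5 : b ≤ b * Real.exp b := le_mul_of_one_le_right hb he
  rw [abs_le]
  constructor
  · have h6 : Real.exp u * Real.exp (-u) = 1 := by rw [← Real.exp_add]; simp
    have h7 : Real.exp u ≤ Real.exp b := Real.exp_le_exp.2 h4
    nlinarith [Real.exp_pos u, mul_le_mul_of_nonneg_left h2 (Real.exp_pos u).le,
      mul_le_mul_of_nonneg_left h7 hb, mul_le_mul_of_nonneg_right h4 (Real.exp_pos u).le]
  · linarith

/-- The difference quotients of `sinhProd`, weighted by `e^{-ψ}`. -/
noncomputable def weightedSlope (s : Finset ι) (a : ι → E) (ψ : E → ℝ) (v : E) (t : ℝ) (x : E) :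
    ℝ :=
  t⁻¹ * (sinhProd s a (x + t • v) - sinhProd s a x) * Real.exp (-ψ x)

/-- By translation invariance, the mean of a difference quotient of `sinhProd` against `e^{-ψ}` is minus
that of the backward difference quotient of `e^{-ψ}` against `sinhProd`. -/
lemma integral_weightedSlope (hψ : Differentiable ℝ ψ) {L : ℝ}
    (hL : ∀ x y, |ψ x - ψ y| ≤ L * ‖x - y‖)
    (hint : Integrable (fun x => sinhProd s a x * Real.exp (-ψ x)) μ) (v : E) {t : ℝ} (ht : 0 < t) :
    Integrable (weightedSlope s a ψ v t) μ ∧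
      ∫ x, weightedSlope s a ψ v t x ∂μ =
        - ∫ x, t⁻¹ * (1 - Real.exp (ψ x - ψ (x - t • v))) *
            (sinhProd s a x * Real.exp (-ψ x)) ∂μ := by
  set g : E → ℝ := fun x => sinhProd s a x * Real.exp (-ψ x) with hg
  set A : E → ℝ := fun x => t⁻¹ * (1 - Real.exp (ψ x - ψ (x - t • v))) * g x with hA
  have hψc := hψ.continuous
  have hAint : Integrable A μ := by
    refine hint.bdd_mul (c := t⁻¹ * (L * ‖t • v‖ * Real.exp (L * ‖t • v‖))) ?_ ?_
    · exact Continuous.aestronglyMeasurable (by fun_prop)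
    · refine Eventually.of_forall fun x => ?_
      rw [norm_mul, Real.norm_of_nonneg (inv_pos.2 ht).le, Real.norm_eq_abs]
      refine mul_le_mul_of_nonneg_left (abs_one_sub_exp_le ?_) (inv_pos.2 ht).le
      simpa using hL x (x - t • v)
  have heq : weightedSlope s a ψ v t =
      fun x => t⁻¹ * (g (x + t • v) - g x) - A (x + t • v) := by
    ext x
    simp only [weightedSlope, hg, hA, add_sub_cancel_right]
    have : Real.exp (-ψ x) = Real.exp (ψ (x + t • v) - ψ x) * Real.exp (-ψ (x + t • v)) := by
      rw [← Real.exp_add]; ring_nf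
    rw [this]
    ring
  have hg1 : Integrable (fun x => g (x + t • v)) μ := hint.comp_add_right _
  have hA1 : Integrable (fun x => A (x + t • v)) μ := hAint.comp_add_right _
  have hg2 : Integrable (fun x => t⁻¹ * (g (x + t • v) - g x)) μ := (hg1.sub hint).const_mul _
  rw [heq]
  refine ⟨hg2.sub hA1, ?_⟩
  rw [integral_sub hg2 hA1, integral_const_mul, integral_sub hg1 hint,
    integral_add_right_eq_self g, integral_add_right_eq_self A]
  ring

variable [FiniteDimensional ℝ E]

/-- The Lipschitz bound on `ψ` dominates the difference quotients of `e^{-ψ}` by a multiple of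
`sinhProd e^{-ψ}`. -/
lemma tendsto_integral_weightedSlope (hψ : Differentiable ℝ ψ) {L : ℝ}
    (hL : ∀ x y, |ψ x - ψ y| ≤ L * ‖x - y‖)
    (hint : Integrable (fun x => sinhProd s a x * Real.exp (-ψ x)) μ) (v : E) :
    Tendsto (fun t : ℝ => ∫ x, weightedSlope s a ψ v t x ∂μ) (𝓝[>] 0)
      (𝓝 (∫ x, ⟪gradient ψ x, v⟫ * (sinhProd s a x * Real.exp (-ψ x)) ∂μ)) := by
  have hψc := hψ.continuous
  have hmain : Tendsto (fun t : ℝ => ∫ x, t⁻¹ * (1 - Real.exp (ψ x - ψ (x - t • v))) *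
      (sinhProd s a x * Real.exp (-ψ x)) ∂μ) (𝓝[>] 0)
      (𝓝 (∫ x, -⟪gradient ψ x, v⟫ * (sinhProd s a x * Real.exp (-ψ x)) ∂μ)) := by
    refine tendsto_integral_filter_of_dominated_convergence
      (fun x => |L| * ‖v‖ * Real.exp (|L| * ‖v‖) * (sinhProd s a x * Real.exp (-ψ x))) ?_ ?_
      (hint.const_mul _) ?_
    · exact Eventually.of_forall fun t =>
        (Continuous.aestronglyMeasurable (by fun_prop)).mul hint.aestronglyMeasurable
    · filter_upwards [Ioc_mem_nhdsGT (zero_lt_one' ℝ)] with t ht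
      refine Eventually.of_forall fun x => ?_
      rw [norm_mul, norm_mul, norm_inv, Real.norm_of_nonneg ht.1.le,
        Real.norm_of_nonneg (mul_nonneg (sinhProd_nonneg x) (Real.exp_pos _).le)]
      refine mul_le_mul_of_nonneg_right ?_ (mul_nonneg (sinhProd_nonneg x) (Real.exp_pos _).le)
      rw [inv_mul_le_iff₀ ht.1]
      have h1 : |ψ x - ψ (x - t • v)| ≤ t * (|L| * ‖v‖) := by
        have := hL x (x - t • v)
        rw [sub_sub_cancel, norm_smul, Real.norm_of_nonneg ht.1.le] at this
        calc _ ≤ L * (t * ‖v‖) := this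
          _ ≤ |L| * (t * ‖v‖) := mul_le_mul_of_nonneg_right (le_abs_self L)
              (mul_nonneg ht.1.le (norm_nonneg v))
          _ = _ := by ring
      have h2 : t * (|L| * ‖v‖) ≤ |L| * ‖v‖ := mul_le_of_le_one_left (by positivity) ht.2
      calc _ ≤ t * (|L| * ‖v‖) * Real.exp (t * (|L| * ‖v‖)) := abs_one_sub_exp_le h1
        _ ≤ t * (|L| * ‖v‖) * Real.exp (|L| * ‖v‖) :=
            mul_le_mul_of_nonneg_left (Real.exp_le_exp.2 h2)
              (mul_nonneg ht.1.le (by positivity))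
        _ = _ := by ring
    · refine Eventually.of_forall fun x => Tendsto.mul_const _ ?_
      have h1 : HasDerivAt (fun t : ℝ => x - t • v) (-v) 0 := by
        simpa using ((hasDerivAt_id (0 : ℝ)).smul_const v).const_sub x
      have h2 : HasDerivAt (fun t : ℝ => ψ (x - t • v)) (fderiv ℝ ψ (x - (0 : ℝ) • v) (-v)) 0 :=
        (hψ _).hasFDerivAt.comp_hasDerivAt 0 h1
      have h3 := ((h2.const_sub (ψ x)).exp).const_sub 1
      have h4 := h3.tendsto_slope_zero_right
      simp only [zero_add, smul_eq_mul, zero_smul, sub_zero, sub_self, Real.exp_zero, map_neg,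
        neg_neg, one_mul] at h4
      rwa [inner_gradient_left]
  have hneg := hmain.neg
  simp only [neg_mul, integral_neg, neg_neg] at hneg
  refine hneg.congr' ?_
  filter_upwards [self_mem_nhdsWithin] with t ht
  exact ((integral_weightedSlope hψ hL hint v ht).2).symm

/-- Integration by parts for `∏ sinh ⟨a_i, x⟩ e^{-ψ}` on the cone, in a direction of the cone.  There is
no boundary term, because the product vanishes on the walls; it is obtained from the translation
invariance of the measure. -/
lemma integral_inner_gradient_mul_sinhProd [DecidableEq ι]
    (hψ : Differentiable ℝ ψ) {L : ℝ}
    (hL : ∀ x y, |ψ x - ψ y| ≤ L * ‖x - y‖)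
    (hint : Integrable (fun x => sinhProd s a x * Real.exp (-ψ x)) μ) {v : E} (hv : v ∈ openCone s a) :
    (∀ i ∈ s, IntegrableOn (fun x => sinhProdCoeff s a i x * Real.exp (-ψ x)) (openCone s a) μ) ∧
      ∫ x, ⟪gradient ψ x, v⟫ * (sinhProd s a x * Real.exp (-ψ x)) ∂μ =
        ∑ i ∈ s, ⟪a i, v⟫ *
          ∫ x in openCone s a, sinhProdCoeff s a i x * Real.exp (-ψ x) ∂μ := by
  have hψc := hψ.continuous
  have hmeas : MeasurableSet (openCone s a) := isOpen_openCone.measurableSet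
  have hB1 := (integral_weightedSlope hψ hL hint v one_pos).1
  set G : E → ℝ := fun x => (∑ i ∈ s, ⟪a i, v⟫ * sinhProdCoeff s a i x) * Real.exp (-ψ x) with hG
  have hlim : ∀ x ∈ openCone s a,
      Tendsto (fun t : ℝ => weightedSlope s a ψ v t x) (𝓝[>] 0) (𝓝 (G x)) := fun x hx => by
    have h := (hasDerivAt_sinhProd hx v).tendsto_slope_zero_right
    simp only [zero_add, smul_eq_mul, zero_smul, add_zero] at h
    exact h.mul_const _
  have hnonneg : ∀ t : ℝ, 0 < t → ∀ x, 0 ≤ weightedSlope s a ψ v t x := fun t ht x =>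
    mul_nonneg (mul_nonneg (inv_pos.2 ht).le (sub_nonneg.2 (sinhProd_le_add hv x ht.le)))
      (Real.exp_pos _).le
  have hbound : ∀ t ∈ Set.Ioc (0 : ℝ) 1, ∀ x,
      weightedSlope s a ψ v t x ≤ weightedSlope s a ψ v 1 x := fun t ht x => by
    refine mul_le_mul_of_nonneg_right ?_ (Real.exp_pos _).le
    simpa using sinhProd_slope_le hv x ht.1 ht.2
  -- The limit of the quotients is bounded by the integrable quotient of step `1`; as all terms of the
  -- sum are nonnegative, each of them is integrable.
  have hGle : ∀ x ∈ openCone s a, G x ≤ weightedSlope s a ψ v 1 x := fun x hx =>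
    le_of_tendsto (hlim x hx) <| by
      filter_upwards [Ioc_mem_nhdsGT (zero_lt_one' ℝ)] with t ht using hbound t ht x
  have hcoeff_nonneg : ∀ x ∈ openCone s a, ∀ i ∈ s, 0 ≤ sinhProdCoeff s a i x := fun x hx i hi =>
    (sinhProd_nonneg x).trans (sinhProd_lt_sinhProdCoeff hx hi).le
  have hcoeff : ∀ i ∈ s,
      IntegrableOn (fun x => sinhProdCoeff s a i x * Real.exp (-ψ x)) (openCone s a) μ := by
    intro i hi
    have h1 : IntegrableOn (fun x => ⟪a i, v⟫ * (sinhProdCoeff s a i x * Real.exp (-ψ x)))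
        (openCone s a) μ := by
      refine Integrable.mono' hB1.integrableOn ?_ ?_
      · have := continuous_sinhProdCoeff (s := s) (a := a) i
        exact Continuous.aestronglyMeasurable (by fun_prop)
      · filter_upwards [ae_restrict_mem hmeas] with x hx
        have h2 := hcoeff_nonneg x hx i hi
        rw [Real.norm_of_nonneg (mul_nonneg (hv i hi).le (mul_nonneg h2 (Real.exp_pos _).le)),
          ← mul_assoc]
        refine le_trans (mul_le_mul_of_nonneg_right ?_ (Real.exp_pos _).le) (hGle x hx)
        exact Finset.single_le_sum (f := fun i => ⟪a i, v⟫ * sinhProdCoeff s a i x)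
          (fun j hj => mul_nonneg (hv j hj).le (hcoeff_nonneg x hx j hj)) hi
    exact (integrable_const_mul_iff (hv i hi).ne'.isUnit _).1 h1
  refine ⟨hcoeff, ?_⟩
  -- The walls are null sets, and outside the closed cone the difference quotients vanish for small `t`.
  have hwall : ∀ᵐ x ∂μ, ∀ i ∈ s, ⟪a i, x⟫ ≠ 0 := by
    rw [Finset.eventually_all]
    intro i hi
    have hne : (innerₗ E (a i)).ker ≠ ⊤ := fun h => (hv i hi).ne' (by
      have : v ∈ (innerₗ E (a i)).ker := by rw [h]; trivial
      simpa using this)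
    have := μ.addHaar_submodule _ hne
    rw [ae_iff]
    convert this using 2
    ext x
    simp
  have htend : Tendsto (fun t : ℝ => ∫ x, weightedSlope s a ψ v t x ∂μ) (𝓝[>] 0)
      (𝓝 (∫ x, (openCone s a).indicator G x ∂μ)) := by
    refine tendsto_integral_filter_of_dominated_convergence (weightedSlope s a ψ v 1) ?_ ?_ hB1 ?_
    · filter_upwards [self_mem_nhdsWithin] with t ht
      exact (integral_weightedSlope hψ hL hint v ht).1.aestronglyMeasurable
    · filter_upwards [Ioc_mem_nhdsGT (zero_lt_one' ℝ)] with t ht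
      refine Eventually.of_forall fun x => ?_
      rw [Real.norm_of_nonneg (hnonneg t ht.1 x)]
      exact hbound t ht x
    · filter_upwards [hwall] with x hx
      by_cases hxc : x ∈ openCone s a
      · rw [Set.indicator_of_mem hxc]
        exact hlim x hxc
      · rw [Set.indicator_of_notMem hxc]
        have hxc' := hxc
        simp only [openCone, Set.mem_ofPred_eq, not_forall, not_lt] at hxc'
        obtain ⟨i, hi, h⟩ := hxc'
        have hneg : ⟪a i, x⟫ < 0 := lt_of_le_of_ne h (hx i hi)
        have hcont : ContinuousAt (fun t : ℝ => ⟪a i, x + t • v⟫) 0 := by fun_prop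
        have hev : ∀ᶠ t : ℝ in 𝓝 0, ⟪a i, x + t • v⟫ < 0 :=
          hcont.eventually_lt_const (by simpa using hneg)
        refine tendsto_const_nhds.congr' ?_
        filter_upwards [nhdsWithin_le_nhds hev] with t ht
        have h0 : x + t • v ∉ openCone s a := fun hmem => ht.not_gt (hmem i hi)
        rw [weightedSlope, sinhProd_of_notMem hxc, sinhProd_of_notMem h0]
        simp
  rw [tendsto_nhds_unique (tendsto_integral_weightedSlope hψ hL hint v) htend,
    integral_indicator hmeas]
  simp only [hG, Finset.sum_mul, mul_assoc]
  rw [integral_finsetSum _ fun i hi => (hcoeff i hi).const_mul _]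
  simp only [integral_const_mul]

/-- The vector form of the integration by parts: the directions of the cone span the space. -/
theorem setIntegral_smul_gradient [DecidableEq ι] (hψ : ContDiff ℝ ∞ ψ) {L : ℝ}
    (hL : ∀ x, ‖gradient ψ x‖ ≤ L) (hne : (openCone s a).Nonempty)
    (hint : IntegrableOn (fun x => (∏ i ∈ s, Real.sinh ⟪a i, x⟫) * Real.exp (-ψ x))
      (openCone s a) μ) :
    (∀ i ∈ s, IntegrableOn (fun x => sinhProdCoeff s a i x * Real.exp (-ψ x)) (openCone s a) μ) ∧
    IntegrableOn (fun x => ((∏ i ∈ s, Real.sinh ⟪a i, x⟫) * Real.exp (-ψ x)) • gradient ψ x)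
      (openCone s a) μ ∧
    ∫ x in openCone s a, ((∏ i ∈ s, Real.sinh ⟪a i, x⟫) * Real.exp (-ψ x)) • gradient ψ x ∂μ =
      ∑ i ∈ s, (∫ x in openCone s a, sinhProdCoeff s a i x * Real.exp (-ψ x) ∂μ) • a i := by
  have hd : Differentiable ℝ ψ := hψ.differentiable (by simp)
  have hLip := abs_sub_le_of_norm_gradient_le hd hL
  have hmeas : MeasurableSet (openCone s a) := isOpen_openCone.measurableSet
  have hind : (openCone s a).indicator
      (fun x => (∏ i ∈ s, Real.sinh ⟪a i, x⟫) * Real.exp (-ψ x)) =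
      fun x => sinhProd s a x * Real.exp (-ψ x) := by
    ext x
    by_cases hx : x ∈ openCone s a
    · rw [Set.indicator_of_mem hx, sinhProd_of_mem hx]
    · rw [Set.indicator_of_notMem hx, sinhProd_of_notMem hx, zero_mul]
  have hint' : Integrable (fun x => sinhProd s a x * Real.exp (-ψ x)) μ := by
    rw [← hind]; exact hint.integrable_indicator hmeas
  have hgint : IntegrableOn
      (fun x => ((∏ i ∈ s, Real.sinh ⟪a i, x⟫) * Real.exp (-ψ x)) • gradient ψ x)
      (openCone s a) μ :=
    hint.smul_bdd L (contDiff_gradient hψ).continuous.aestronglyMeasurable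
      (Eventually.of_forall hL)
  refine ⟨?_, hgint, ?_⟩
  · obtain ⟨v, hv⟩ := hne
    exact (integral_inner_gradient_mul_sinhProd hd hLip hint' hv).1
  set A := ∫ x in openCone s a,
    ((∏ i ∈ s, Real.sinh ⟪a i, x⟫) * Real.exp (-ψ x)) • gradient ψ x ∂μ with hA
  set B := ∑ i ∈ s, (∫ x in openCone s a, sinhProdCoeff s a i x * Real.exp (-ψ x) ∂μ) • a i with hB
  have key : ∀ v ∈ openCone s a, ⟪v, A - B⟫ = 0 := fun v hv => by
    have h1 : ⟪v, A⟫ = ∫ x, ⟪gradient ψ x, v⟫ * (sinhProd s a x * Real.exp (-ψ x)) ∂μ := by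
      rw [hA, ← integral_inner hgint v, ← integral_indicator hmeas]
      refine integral_congr_ae (Eventually.of_forall fun x => ?_)
      simp only
      rw [← congrFun hind x]
      by_cases hx : x ∈ openCone s a
      · simp only [Set.indicator_of_mem hx, real_inner_smul_right, real_inner_comm v]
        ring
      · simp only [Set.indicator_of_notMem hx, mul_zero]
    rw [inner_sub_right, h1, (integral_inner_gradient_mul_sinhProd hd hLip hint' hv).2, hB,
      inner_sum, sub_eq_zero]
    refine Finset.sum_congr rfl fun i _ => ?_
    rw [real_inner_smul_right, real_inner_comm, mul_comm]
  obtain ⟨v, hv⟩ := hne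
  have hcont : ContinuousAt (fun t : ℝ => v + t • (A - B)) 0 := by fun_prop
  have hev : ∀ᶠ t : ℝ in 𝓝[>] 0, v + t • (A - B) ∈ openCone s a :=
    nhdsWithin_le_nhds (hcont.eventually_mem (isOpen_openCone.mem_nhds (by simpa using hv)))
  -- `A - B` is orthogonal to `v` and to `v + t (A - B)`, hence to itself.
  obtain ⟨t, ht, htpos⟩ := (hev.and self_mem_nhdsWithin).exists
  have h := key _ ht
  rw [inner_add_left, key v hv, zero_add, real_inner_smul_left] at h
  have h0 := (mul_eq_zero.1 h).resolve_left (ne_of_gt htpos)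
  exact sub_eq_zero.1 (inner_self_eq_zero.1 h0)

end IntegrationByParts

/-! ### Cones, bases of root pairings and horosymmetric data -/

section ConeInterior

/-- The coefficient map from `ℝˢ` onto the span of the `a_i` is open, so it takes the open orthant into
the interior, relative to the span, of the cone generated by the `a_i`. -/
lemma sum_smul_mem_intrinsicInterior_hull {ι V : Type*} [NormedAddCommGroup V]
    [InnerProductSpace ℝ V] [FiniteDimensional ℝ V] (s : Finset ι) (a : ι → V) {c : ι → ℝ}
    (hc : ∀ i ∈ s, 0 < c i) :
    ∑ i ∈ s, c i • a i ∈
      intrinsicInterior ℝ (PointedCone.hull ℝ (a '' (s : Set ι)) : Set V) := by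
  classical
  let S : Submodule ℝ V := Submodule.span ℝ (a '' (s : Set ι))
  have haS : ∀ i : s, a i ∈ S := fun i => Submodule.subset_span ⟨i, i.2, rfl⟩
  let b : s → S := fun i => ⟨a i, haS i⟩
  let T : (s → ℝ) →ₗ[ℝ] S := Fintype.linearCombination ℝ b
  have hTsurj : Function.Surjective T := by
    rw [← LinearMap.range_eq_top, Fintype.range_linearCombination]
    refine Submodule.map_injective_of_injective S.injective_subtype ?_
    rw [Submodule.map_span, Submodule.map_subtype_top, ← Set.range_comp]
    congr 1
    ext v
    simp [b]
  have hTopen : IsOpenMap T := T.isOpenMap_of_finiteDimensional hTsurj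
  let K : Set S := {v | (v : V) ∈ PointedCone.hull ℝ (a '' (s : Set ι))}
  let O : Set (s → ℝ) := Set.univ.pi fun _ => Set.Ioi 0
  have hO : IsOpen O := isOpen_set_pi Set.finite_univ fun _ _ => isOpen_Ioi
  have hTK : T '' O ⊆ K := by
    rintro _ ⟨f, hf, rfl⟩
    have : (T f : V) = ∑ i, f i • a i := by simp [T, b, Fintype.linearCombination_apply]
    change (T f : V) ∈ PointedCone.hull ℝ (a '' (s : Set ι))
    rw [this]
    refine Submodule.sum_mem _ fun i _ => ?_
    exact (PointedCone.hull ℝ (a '' (s : Set ι))).smul_mem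
      (hf i trivial).le (Submodule.subset_span ⟨i, i.2, rfl⟩)
  have hKimg : (PointedCone.hull ℝ (a '' (s : Set ι)) : Set V) =
      S.subtypeₗᵢ.toAffineIsometry '' K := by
    ext v
    constructor
    · intro hv
      have hvS : v ∈ S := by
        have hle : PointedCone.hull ℝ (a '' (s : Set ι)) ≤ (S : PointedCone ℝ V) :=
          Submodule.span_le.2 Submodule.subset_span
        exact hle hv
      exact ⟨⟨v, hvS⟩, hv, rfl⟩
    · rintro ⟨w, hw, rfl⟩
      exact hw
  rw [hKimg, AffineIsometry.intrinsicInterior_image]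
  refine ⟨T fun i => c i, interior_subset_intrinsicInterior
    (interior_maximal hTK (hTopen _ hO) ⟨_, fun i _ => hc i i.2, rfl⟩), ?_⟩
  have : ((T fun i => c i : S) : V) = ∑ i : s, c i • a i := by
    simp [T, b, Fintype.linearCombination_apply]
  change ((T fun i => c i : S) : V) = _
  rw [this]
  exact Finset.sum_coe_sort s fun i => c i • a i

end ConeInterior

namespace RootPairing.Base

variable {ι R M N : Type*} [Field R] [AddCommGroup M] [Module R M] [AddCommGroup N]
  [Module R N] {P : RootPairing ι R M N} (b : P.Base)

lemma exists_linearMap_root_eq (c : ι → R) : ∃ φ : M →ₗ[R] R, ∀ j ∈ b.support, φ (P.root j) = c j := by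
  have hli := b.linearIndepOn_root
  let B := Module.Basis.span hli
  obtain ⟨φ, hφ⟩ := LinearMap.exists_extend (B.constr R fun j : (b.support : Set ι) => c j)
  refine ⟨φ, fun j hj => ?_⟩
  have h1 : ((B ⟨j, hj⟩ : _) : M) = P.root j :=
    congrArg Subtype.val (Module.Basis.span_apply hli ⟨j, hj⟩)
  have h2 := LinearMap.congr_fun hφ (B ⟨j, hj⟩)
  rw [Module.Basis.constr_basis] at h2
  simpa [h1] using h2

variable [CharZero R]

lemma exists_root_eq_sum_of_isPos {i : ι} (hi : b.IsPos i) :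
    ∃ f : ι → ℕ, P.root i = ∑ j ∈ b.support, f j • P.root j := by
  obtain ⟨f, -, h | h⟩ := b.exists_root_eq_sum_nat_or_neg i
  · exact ⟨f, h⟩
  · have h1 : P.root i = ∑ j ∈ b.support, (fun j => -(f j : ℤ)) j • P.root j := by
      simp [h]
    have h2 := height_eq_sum h1
    have h3 : ∑ j ∈ b.support, -(f j : ℤ) ≤ 0 :=
      Finset.sum_nonpos fun j _ => by simp
    rw [isPos_iff, h2] at hi
    exact absurd hi h3.not_gt

lemma isPos_or_exists_neg (i : ι) : b.IsPos i ∨ ∃ j, b.IsPos j ∧ P.root j = -P.root i := by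
  let := P.indexNeg
  refine (IsPos.or_neg (b := b) i).imp_right fun h => ⟨-i, h, by simp⟩

end RootPairing.Base

namespace HorosymmetricDatum

variable {ι 𝔞 : Type*} [Fintype ι] [NormedAddCommGroup 𝔞] [InnerProductSpace ℝ 𝔞]
  (D : HorosymmetricDatum ι 𝔞)

lemma mem_sPos {i : ι} :
    i ∈ D.sPos ↔ D.base.IsPos i ∧ i ∈ D.levi ∧ D.σ (D.R.root i) ≠ D.R.root i := by
  simp [sPos]

lemma mem_uPos {i : ι} : i ∈ D.uPos ↔ D.base.IsPos i ∧ i ∉ D.levi := by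
  simp [uPos]

lemma mem_aPrime {x : 𝔞} : x ∈ D.aPrime ↔ D.σ x = -x := Iff.rfl

lemma reflection_eq (i : ι) (x : 𝔞) :
    D.R.reflection i x = x - ⟪x, D.R.coroot i⟫ • D.R.root i := by
  rw [RootPairing.reflection_apply, ← D.pairing_eq]
  rfl

lemma inner_root_coroot_self (i : ι) : ⟪D.R.root i, D.R.coroot i⟫ = 2 := by
  rw [← D.pairing_eq]
  exact D.R.root_coroot_two i

/-- For an invariant inner product the coroot of a root `α` is `2 α / (α, α)`. -/
lemma inner_coroot_mul {i : ι} (hi : i ∈ D.levi) (x : 𝔞) :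
    ⟪x, D.R.coroot i⟫ * ⟪D.R.root i, D.R.root i⟫ = 2 * ⟪x, D.R.root i⟫ := by
  let f : 𝔞 →ₗᵢ[ℝ] 𝔞 := ⟨D.R.reflection i, D.inner_invariant i hi⟩
  have h : ⟪D.R.reflection i x, D.R.reflection i (D.R.root i)⟫ = ⟪x, D.R.root i⟫ :=
    f.inner_map_map x (D.R.root i)
  rw [D.reflection_eq, D.reflection_eq, inner_root_coroot_self, inner_sub_left,
    real_inner_smul_left, inner_sub_right, inner_sub_right, real_inner_smul_right,
    real_inner_smul_right] at h
  linarith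

lemma inner_coroot_pos_iff {i : ι} (hi : i ∈ D.levi) (x : 𝔞) :
    0 < ⟪x, D.R.coroot i⟫ ↔ 0 < ⟪D.R.root i, x⟫ := by
  have h0 : 0 < ⟪D.R.root i, D.R.root i⟫ := real_inner_self_pos.2 (D.R.ne_zero i)
  rw [← mul_pos_iff_of_pos_right h0, D.inner_coroot_mul hi, real_inner_comm x]
  simp

/-- The linear form that is `0` on the simple roots of `L` and `1` on the other simple roots separates
`Φ_u` from `Φ_L`. -/
lemma exists_linearMap_levi : ∃ φ : 𝔞 →ₗ[ℝ] ℝ,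
    (∀ i ∈ D.levi, φ (D.R.root i) = 0) ∧ (∀ i, D.base.IsPos i → 0 ≤ φ (D.R.root i)) ∧
      ∀ i ∈ D.uPos, 0 < φ (D.R.root i) := by
  classical
  obtain ⟨φ, hφ⟩ := D.base.exists_linearMap_root_eq fun j => if j ∈ D.leviSimple then 0 else 1
  have hsum : ∀ f : ι → ℕ, φ (∑ j ∈ D.base.support, f j • D.R.root j) =
      ∑ j ∈ D.base.support, f j • (if j ∈ D.leviSimple then (0 : ℝ) else 1) := fun f => by
    rw [map_sum]
    exact Finset.sum_congr rfl fun j hj => by rw [map_nsmul, hφ j hj]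
  have hnn : ∀ (f : ι → ℕ), ∀ j ∈ D.base.support,
      0 ≤ f j • (if j ∈ D.leviSimple then (0 : ℝ) else 1) := fun f j _ => by
    split_ifs <;> simp
  refine ⟨φ, fun i hi => ?_, fun i hi => ?_, fun i hi => ?_⟩
  · have hle : Submodule.span ℝ (D.R.root '' D.leviSimple) ≤ φ.ker := by
      rw [Submodule.span_le]
      rintro _ ⟨j, hj, rfl⟩
      simp [hφ j (D.leviSimple_subset hj), hj]
    exact hle hi
  · obtain ⟨f, hf⟩ := D.base.exists_root_eq_sum_of_isPos hi
    rw [hf, hsum]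
    exact Finset.sum_nonneg (hnn f)
  · obtain ⟨hpos, hlevi⟩ := D.mem_uPos.1 hi
    obtain ⟨f, hf⟩ := D.base.exists_root_eq_sum_of_isPos hpos
    rw [hf, hsum]
    refine lt_of_le_of_ne (Finset.sum_nonneg (hnn f)) fun h0 => hlevi ?_
    have hz := (Finset.sum_eq_zero_iff_of_nonneg (hnn f)).1 h0.symm
    change D.R.root i ∈ Submodule.span ℝ (D.R.root '' D.leviSimple)
    rw [hf]
    refine Submodule.sum_mem _ fun j hj => ?_
    by_cases hjl : j ∈ D.leviSimple
    · exact (Submodule.span ℝ _).smul_of_tower_mem (f j) (Submodule.subset_span ⟨j, hjl, rfl⟩)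
    · have := hz j hj
      simp only [hjl, if_false, nsmul_eq_mul, mul_one, Nat.cast_eq_zero] at this
      simp [this]

lemma reflectionPerm_mem_uPos {i : ι} (hi : i ∈ D.levi) {j : ι} (hj : j ∈ D.uPos) :
    D.R.reflectionPerm i j ∈ D.uPos := by
  obtain ⟨φ, hlevi, hnn, hu⟩ := D.exists_linearMap_levi
  have h1 : φ (D.R.root (D.R.reflectionPerm i j)) = φ (D.R.root j) := by
    rw [RootPairing.root_reflectionPerm, reflection_eq, map_sub, map_smul, hlevi i hi, smul_zero,
      sub_zero]
  have h2 := hu j hj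
  refine D.mem_uPos.2 ⟨?_, fun h => by rw [← h1, hlevi _ h] at h2; exact h2.false⟩
  rcases D.base.isPos_or_exists_neg (D.R.reflectionPerm i j) with h | ⟨k, hk, hkr⟩
  · exact h
  · have := hnn k hk
    rw [hkr, map_neg, h1] at this
    linarith

/-- `2ρ_u` is invariant under the Weyl group of `L`, which permutes `Φ_u`. -/
lemma inner_twoRhoU_coroot {i : ι} (hi : i ∈ D.levi) : ⟪D.twoRhoU, D.R.coroot i⟫ = 0 := by
  have h : D.R.reflection i D.twoRhoU = D.twoRhoU := by
    rw [twoRhoU, map_sum]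
    refine Finset.sum_nbij' (D.R.reflectionPerm i) (D.R.reflectionPerm i)
      (fun j hj => D.reflectionPerm_mem_uPos hi hj) (fun j hj => D.reflectionPerm_mem_uPos hi hj)
      (fun j _ => D.R.reflectionPerm_self i j) (fun j _ => D.R.reflectionPerm_self i j)
      fun j _ => by rw [RootPairing.root_reflectionPerm]
  rw [reflection_eq, sub_eq_self] at h
  exact (smul_eq_zero.1 h).resolve_right (D.R.ne_zero i)

lemma exists_mem_sPos_root_eq_neg {i : ι} (hi : i ∈ D.sPos) :
    ∃ j ∈ D.sPos, D.R.root j = -D.σ (D.R.root i) := by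
  obtain ⟨hpos, hlevi, hne⟩ := D.mem_sPos.1 hi
  obtain ⟨j, hj, hjr⟩ := D.σ_adapted i hlevi hpos hne
  obtain ⟨k, hk, hkr⟩ := D.σ_root i hlevi
  refine ⟨j, D.mem_sPos.2 ⟨hj, ?_, fun h => ?_⟩, hjr⟩
  · change D.R.root j ∈ Submodule.span ℝ _
    rw [hjr, ← hkr]
    exact Submodule.neg_mem _ hk
  · rw [hjr, map_neg, D.σ_involutive, neg_inj] at h
    exact hne h.symm

lemma inner_sigma_left (x y : 𝔞) : ⟪D.σ x, y⟫ = ⟪x, D.σ y⟫ := by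
  rw [← D.σ.inner_map_map, D.σ_involutive]

variable [FiniteDimensional ℝ 𝔞]

/-- If `y` is positive on all positive roots, then `y - σ y` lies in the chamber. -/
lemma chamber_nonempty : D.chamber.Nonempty := by
  obtain ⟨φ, hφ⟩ := D.base.exists_linearMap_root_eq fun _ => 1
  have hpos : ∀ i, D.base.IsPos i → 0 < φ (D.R.root i) := fun i hi => by
    obtain ⟨f, hf⟩ := D.base.exists_root_eq_sum_of_isPos hi
    have h1 : D.R.root i = ∑ j ∈ D.base.support, (fun j => (f j : ℤ)) j • D.R.root j := by
      simp [hf]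
    have h2 : 0 < ∑ j ∈ D.base.support, (f j : ℤ) := by
      rwa [RootPairing.Base.isPos_iff, RootPairing.Base.height_eq_sum h1] at hi
    have h3 : φ (D.R.root i) = ∑ j ∈ D.base.support, (f j : ℝ) := by
      rw [hf, map_sum]
      exact Finset.sum_congr rfl fun j hj => by rw [map_nsmul, hφ j hj, nsmul_eq_mul, mul_one]
    rw [h3]
    exact_mod_cast h2
  set y := (InnerProductSpace.toDual ℝ 𝔞).symm φ.toContinuousLinearMap
  have hy : ∀ x, ⟪x, y⟫ = φ x := fun x => by
    rw [real_inner_comm, InnerProductSpace.toDual_symm_apply]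
    rfl
  refine ⟨⟨y - D.σ y, by rw [mem_aPrime, map_sub, D.σ_involutive, neg_sub]⟩, fun i hi => ?_⟩
  obtain ⟨j, hj, hjr⟩ := D.exists_mem_sPos_root_eq_neg hi
  have h1 := hpos i (D.mem_sPos.1 hi).1
  have h2 := hpos j (D.mem_sPos.1 hj).1
  rw [hjr, map_neg] at h2
  simp only
  rw [inner_sub_right, ← D.inner_sigma_left, hy, hy]
  linarith

/-- The restriction of a root to `𝔞'`, as a vector of `𝔞'`. -/
noncomputable def restrictedRoot (i : ι) : D.aPrime := D.aPrime.orthogonalProjectionOnto (D.R.root i)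

lemma inner_restrictedRoot (i : ι) (x : D.aPrime) :
    ⟪D.restrictedRoot i, x⟫ = ⟪D.R.root i, (x : 𝔞)⟫ := by
  rw [restrictedRoot, Submodule.inner_orthogonalProjectionOnto_eq_of_mem_right]

lemma coe_restrictedRoot (i : ι) :
    (D.restrictedRoot i : 𝔞) = (2 : ℝ)⁻¹ • (D.R.root i - D.σ (D.R.root i)) := by
  have hmem : (2 : ℝ)⁻¹ • (D.R.root i - D.σ (D.R.root i)) ∈ D.aPrime := by
    rw [mem_aPrime, map_smul, map_sub, D.σ_involutive, ← smul_neg, neg_sub]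
  have := ext_inner_right ℝ (x := D.restrictedRoot i) (y := ⟨_, hmem⟩) fun x => by
    rw [inner_restrictedRoot, Submodule.coe_inner, real_inner_smul_left, inner_sub_left,
      D.inner_sigma_left, D.mem_aPrime.1 x.2, inner_neg_right]
    ring
  rw [this]

/-- Since `-σ` permutes `Φ_s⁺`, a combination of the restrictions of the roots of `Φ_s⁺` is a
combination of the roots themselves, with the coefficients averaged over the orbits of `-σ`.  The
function `τ` is that permutation. -/
lemma exists_sum_smul_restrictedRoot_eq : ∃ τ : ι → ι, (∀ i ∈ D.sPos, τ i ∈ D.sPos) ∧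
    ∀ k : ι → ℝ, ∑ i ∈ D.sPos, k i • (D.restrictedRoot i : 𝔞) =
      ∑ i ∈ D.sPos, ((k i + k (τ i)) / 2) • D.R.root i := by
  have h : ∀ i, ∃ j, i ∈ D.sPos → j ∈ D.sPos ∧ D.R.root j = -D.σ (D.R.root i) := fun i => by
    by_cases hi : i ∈ D.sPos
    · obtain ⟨j, hj⟩ := D.exists_mem_sPos_root_eq_neg hi
      exact ⟨j, fun _ => hj⟩
    · exact ⟨i, fun h => absurd h hi⟩
  choose τ hτ using h
  have hinv : ∀ i ∈ D.sPos, τ (τ i) = i := fun i hi => D.R.root.injective <| by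
    rw [(hτ _ (hτ i hi).1).2, (hτ i hi).2, map_neg, D.σ_involutive, neg_neg]
  refine ⟨τ, fun i hi => (hτ i hi).1, fun k => ?_⟩
  have h1 : ∑ i ∈ D.sPos, (k i / 2) • D.R.root (τ i) =
      ∑ i ∈ D.sPos, (k (τ i) / 2) • D.R.root i :=
    Finset.sum_nbij' τ τ (fun i hi => (hτ i hi).1) (fun i hi => (hτ i hi).1) hinv hinv
      fun i hi => by rw [hinv i hi]
  simp only [add_div, add_smul, Finset.sum_add_distrib]
  rw [← h1, ← Finset.sum_add_distrib]
  refine Finset.sum_congr rfl fun i hi => ?_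
  rw [coe_restrictedRoot, (hτ i hi).2]
  module

end HorosymmetricDatum

/-! ### Kähler potentials and full mass -/

lemma gradient_map_of_comp_eq {E : Type*} [NormedAddCommGroup E] [InnerProductSpace ℝ E]
    [CompleteSpace E] {ψ : E → ℝ} (hψ : Differentiable ℝ ψ) (e : E ≃ₗᵢ[ℝ] E)
    (he : ∀ x, ψ (e x) = ψ x) (x : E) : gradient ψ (e x) = e (gradient ψ x) := by
  refine ext_inner_right ℝ fun v => ?_
  obtain ⟨w, rfl⟩ := e.surjective v
  rw [e.inner_map_map, inner_gradient_left, inner_gradient_left]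
  have h1 : HasFDerivAt (fun y => ψ (e y)) ((fderiv ℝ ψ (e x)).comp (e : E →L[ℝ] E)) x :=
    (hψ (e x)).hasFDerivAt.comp x (e : E →L[ℝ] E).hasFDerivAt
  simp only [he] at h1
  rw [h1.fderiv]
  rfl

namespace HorosymmetricDatum

variable {ι 𝔞 : Type*} [Fintype ι] [NormedAddCommGroup 𝔞] [InnerProductSpace ℝ 𝔞]
  {D : HorosymmetricDatum ι 𝔞}

lemma jZero_pos {x : D.aPrime} (hx : x ∈ D.chamber) : 0 < D.jZero x :=
  Finset.prod_pos fun i hi => Real.sinh_pos_iff.2 (hx i hi)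

lemma continuous_piZero : Continuous D.piZero := by
  unfold piZero
  fun_prop

variable [FiniteDimensional ℝ 𝔞]

lemma chamber_eq_openCone : D.chamber = openCone D.sPos D.restrictedRoot := by
  ext x
  simp only [chamber, openCone, inner_restrictedRoot, Set.mem_ofPred_eq]

lemma isOpen_chamber : IsOpen D.chamber := by
  rw [chamber_eq_openCone]; exact isOpen_openCone

lemma jZero_eq (x : D.aPrime) :
    D.jZero x = ∏ i ∈ D.sPos, Real.sinh ⟪D.restrictedRoot i, x⟫ := by
  simp only [jZero, inner_restrictedRoot]

lemma restrictedRoot_ne_zero {i : ι} (hi : i ∈ D.sPos) : D.restrictedRoot i ≠ 0 := by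
  obtain ⟨v, hv⟩ := D.chamber_nonempty
  intro h
  have := hv i hi
  rw [← inner_restrictedRoot, h, inner_zero_left] at this
  exact this.false

lemma inner_coe_coroot_pos_iff {i : ι} (hi : i ∈ D.sPos) (z : D.aPrime) :
    0 < ⟪(z : 𝔞), D.R.coroot i⟫ ↔ 0 < ⟪D.restrictedRoot i, z⟫ := by
  rw [D.inner_coroot_pos_iff (D.mem_sPos.1 hi).2.1, inner_restrictedRoot]

lemma restrictedReflection_apply (i : ι) (x : D.aPrime) :
    D.restrictedReflection i x =
      x - (2 * (⟪D.restrictedRoot i, x⟫ / ‖D.restrictedRoot i‖ ^ 2)) • D.restrictedRoot i := by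
  rw [restrictedReflection, Submodule.reflection_orthogonal_apply,
    Submodule.reflection_singleton_apply]
  change -(2 • (⟪D.restrictedRoot i, x⟫ / ‖D.restrictedRoot i‖ ^ 2) • D.restrictedRoot i - x) = _
  module

namespace IsKahlerPotential

variable {ψ : D.aPrime → ℝ}

lemma hess_form_pos (hψ : D.IsKahlerPotential ψ) (x v : D.aPrime) (hv : v ≠ 0) :
    0 < ⟪fderiv ℝ (gradient ψ) x v, v⟫ := by
  have h : 0 < ⟪fderiv ℝ (gradient ψ) x v, v⟫ / 4 := hψ.hess_pos x v hv
  linarith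

lemma det_hess_pos (hψ : D.IsKahlerPotential ψ) (x : D.aPrime) : 0 < (D.hess ψ x).det :=
  det_pos_of_inner_pos _ fun v hv => hψ.hess_form_pos x v hv

lemma hasFDerivAt_grad (hψ : D.IsKahlerPotential ψ) (x : D.aPrime) :
    HasFDerivAt (D.grad ψ) (D.hess ψ x) x :=
  ((contDiff_gradient hψ.smooth).differentiable (by simp) x).hasFDerivAt

lemma grad_injective (hψ : D.IsKahlerPotential ψ) : Function.Injective (D.grad ψ) :=
  gradient_injective hψ.smooth hψ.hess_form_pos

lemma inner_grad_coroot_pos (hψ : D.IsKahlerPotential ψ) {x : D.aPrime} (hx : x ∈ D.chamber)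
    {i : ι} (hi : i ∈ D.sPos) : 0 < ⟪(D.grad ψ x : 𝔞), D.R.coroot i⟫ :=
  (div_pos_iff_of_pos_right (mul_pos two_pos (Real.sinh_pos_iff.2 (hx i hi)))).1
    (hψ.s_pos x hx i hi)

lemma piZero_shiftedGrad_pos (hψ : D.IsKahlerPotential ψ) {x : D.aPrime} (hx : x ∈ D.chamber) :
    0 < D.piZero (D.shiftedGrad ψ x) := by
  refine mul_pos (Finset.prod_pos fun i hi => ?_) (Finset.prod_pos fun i hi => ?_)
  · rw [shiftedGrad, inner_add_left, D.inner_twoRhoU_coroot (D.mem_sPos.1 hi).2.1, add_zero]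
    exact hψ.inner_grad_coroot_pos hx hi
  · have h := hψ.u_pos x hx i hi
    rw [mul_div_assoc] at h
    linarith [pos_of_mul_pos_right h (Real.exp_pos _).le]

/-- The gradient maps only the chamber into the chamber: it commutes with the restricted reflections,
and it is strictly monotone. -/
lemma mem_chamber_of_inner_grad_pos (hψ : D.IsKahlerPotential ψ) {x : D.aPrime}
    (hx : ∀ i ∈ D.sPos, 0 < ⟪(D.grad ψ x : 𝔞), D.R.coroot i⟫) : x ∈ D.chamber := by
  intro i hi
  rw [← inner_restrictedRoot]
  have hg := (inner_coe_coroot_pos_iff hi _).1 (hx i hi)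
  set a := D.restrictedRoot i
  have hN : 0 < ‖a‖ ^ 2 := pow_pos (norm_pos_iff.2 (restrictedRoot_ne_zero hi)) 2
  have heq : D.grad ψ (D.restrictedReflection i x) = D.restrictedReflection i (D.grad ψ x) :=
    gradient_map_of_comp_eq (hψ.smooth.differentiable (by simp)) (D.restrictedReflection i)
      (hψ.weyl_invariant i hi) x
  have hsub : ∀ y : D.aPrime,
      D.restrictedReflection i y - y = -((2 * (⟪a, y⟫ / ‖a‖ ^ 2)) • a) := fun y => by
    rw [restrictedReflection_apply]; simp [a]
  -- A point of the wall has its gradient on the wall.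
  have hne : x ≠ D.restrictedReflection i x := fun h => by
    rw [← h] at heq
    have h1 := hsub (D.grad ψ x)
    rw [← heq, sub_self, eq_comm, neg_eq_zero, smul_eq_zero] at h1
    rcases h1 with h1 | h1
    · have : 0 < 2 * (⟪a, D.grad ψ x⟫ / ‖a‖ ^ 2) := by positivity
      exact this.ne' h1
    · exact restrictedRoot_ne_zero hi h1
  have hmono : 0 < ⟪D.grad ψ (D.restrictedReflection i x) - D.grad ψ x,
      D.restrictedReflection i x - x⟫ :=
    inner_gradient_sub_pos hψ.smooth hψ.hess_form_pos hne
  rw [heq, hsub, hsub, inner_neg_neg, real_inner_smul_left, real_inner_smul_right,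
    real_inner_self_eq_norm_sq] at hmono
  have h2 : 2 * (⟪a, D.grad ψ x⟫ / ‖a‖ ^ 2) * (2 * (⟪a, x⟫ / ‖a‖ ^ 2) * ‖a‖ ^ 2) =
      4 * ⟪a, D.grad ψ x⟫ / ‖a‖ ^ 2 * ⟪a, x⟫ := by
    field_simp; ring
  rw [h2] at hmono
  exact pos_of_mul_pos_right hmono (by positivity)

variable [MeasurableSpace 𝔞] [BorelSpace 𝔞]

lemma setIntegral_image_grad (hψ : D.IsKahlerPotential ψ) {F : Type*} [NormedAddCommGroup F]
    [NormedSpace ℝ F] (f : D.aPrime → F) :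
    ∫ z in D.grad ψ '' D.chamber, f z = ∫ x in D.chamber, (D.hess ψ x).det • f (D.grad ψ x) := by
  rw [integral_image_eq_integral_abs_det_fderiv_smul volume isOpen_chamber.measurableSet
    (fun x _ => (hψ.hasFDerivAt_grad x).hasFDerivWithinAt) hψ.grad_injective.injOn]
  exact integral_congr_ae (Filter.Eventually.of_forall fun x => by
    simp only [abs_of_pos (hψ.det_hess_pos x)])

lemma integrableOn_image_grad_iff (hψ : D.IsKahlerPotential ψ) {F : Type*} [NormedAddCommGroup F]
    [NormedSpace ℝ F] (f : D.aPrime → F) :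
    IntegrableOn f (D.grad ψ '' D.chamber) ↔
      IntegrableOn (fun x => (D.hess ψ x).det • f (D.grad ψ x)) D.chamber := by
  rw [integrableOn_image_iff_integrableOn_abs_det_fderiv_smul volume isOpen_chamber.measurableSet
    (fun x _ => (hψ.hasFDerivAt_grad x).hasFDerivWithinAt) hψ.grad_injective.injOn]
  exact iff_of_eq (congrArg (fun g => IntegrableOn g D.chamber volume) (funext fun x => by
    rw [abs_of_pos (hψ.det_hess_pos x)]))

lemma measurableSet_image_grad (hψ : D.IsKahlerPotential ψ) :
    MeasurableSet (D.grad ψ '' D.chamber) :=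
  measurable_image_of_fderivWithin isOpen_chamber.measurableSet
    (fun x _ => (hψ.hasFDerivAt_grad x).hasFDerivWithinAt) hψ.grad_injective.injOn

lemma metricVolume_eq (hψ : D.IsKahlerPotential ψ) :
    D.metricVolume ψ = ∫ z in D.grad ψ '' D.chamber, D.piZero ((z : 𝔞) + D.twoRhoU) := by
  rw [hψ.setIntegral_image_grad, metricVolume]
  simp only [smul_eq_mul, mul_comm, shiftedGrad]

end IsKahlerPotential

namespace Compactification

variable (M : D.Compactification) {ψ : D.aPrime → ℝ}

lemma level_cast_pos : (0 : ℝ) < M.level := Nat.cast_pos.2 M.level_pos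

lemma isKahlerPotential_admissiblePotential : D.IsKahlerPotential M.admissiblePotential := M.kahler

lemma mem_two_smul_dominantPart {z : D.aPrime} :
    z ∈ (2 : ℝ) • M.dominantPart ↔
      z ∈ (M.level : ℝ)⁻¹ • convexHull ℝ (M.weights : Set D.aPrime) ∧
        ∀ i ∈ D.sPos, 0 ≤ ⟪(z : 𝔞), D.R.coroot i⟫ := by
  rw [Set.mem_smul_set_iff_inv_smul_mem₀ two_ne_zero, dominantPart, Set.mem_ofPred_eq,
    momentPolytope, mul_inv, mul_smul, Set.smul_mem_smul_set_iff₀ (by norm_num)]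
  refine and_congr_right fun _ => forall₂_congr fun i _ => ?_
  rw [Submodule.coe_smul, real_inner_smul_left]
  exact mul_nonneg_iff_of_pos_left (by norm_num)

lemma isCompact_two_smul_dominantPart : IsCompact ((2 : ℝ) • M.dominantPart) := by
  have : (2 : ℝ) • M.dominantPart = ((M.level : ℝ)⁻¹ • convexHull ℝ (M.weights : Set D.aPrime)) ∩
      ⋂ i ∈ D.sPos, {z : D.aPrime | 0 ≤ ⟪(z : 𝔞), D.R.coroot i⟫} := by
    ext z
    simp [mem_two_smul_dominantPart]
  rw [this]
  exact (isCompact_smul_convexHull _ _).inter_right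
    (isClosed_biInter fun i _ => isClosed_le continuous_const (by fun_prop))

lemma grad_mem_of_le (hψ : D.IsKahlerPotential ψ) {C : ℝ}
    (hC : ∀ x, ψ x ≤ M.admissiblePotential x + C) (x : D.aPrime) :
    D.grad ψ x ∈ (M.level : ℝ)⁻¹ • convexHull ℝ (M.weights : Set D.aPrime) :=
  gradient_mem_smul_convexHull hψ.smooth hψ.hess_form_pos M.level_cast_pos M.weights_nonempty
    M.coeff_pos hC x

lemma image_grad_subset (hψ : D.IsKahlerPotential ψ) {C : ℝ}
    (hC : ∀ x, ψ x ≤ M.admissiblePotential x + C) :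
    D.grad ψ '' D.chamber ⊆ (2 : ℝ) • M.dominantPart := by
  rintro _ ⟨x, hx, rfl⟩
  exact M.mem_two_smul_dominantPart.2
    ⟨M.grad_mem_of_le hψ hC x, fun i hi => (hψ.inner_grad_coroot_pos hx hi).le⟩

variable [MeasurableSpace 𝔞] [BorelSpace 𝔞]

/-- The gradients of the admissible potential on the chamber exhaust `2P₊`, up to the frontier of `P`
and the walls. -/
lemma ae_mem_image_grad_admissiblePotential :
    ∀ᵐ z : D.aPrime, z ∈ (2 : ℝ) • M.dominantPart →
      z ∈ D.grad M.admissiblePotential '' D.chamber := by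
  have hK := M.isKahlerPotential_admissiblePotential
  have hfront : ∀ᵐ z : D.aPrime,
      z ∉ frontier ((M.level : ℝ)⁻¹ • convexHull ℝ (M.weights : Set D.aPrime)) :=
    measure_eq_zero_iff_ae_notMem.1 ((convex_smul_convexHull _ _).addHaar_frontier volume)
  have hwall : ∀ᵐ z : D.aPrime, ∀ i ∈ D.sPos, ⟪(z : 𝔞), D.R.coroot i⟫ ≠ 0 := by
    rw [Finset.eventually_all]
    intro i hi
    obtain ⟨v, hv⟩ := D.chamber_nonempty
    let f : D.aPrime →ₗ[ℝ] ℝ := (innerₗ 𝔞 (D.R.coroot i)).comp D.aPrime.subtype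
    have hf : ∀ z : D.aPrime, f z = ⟪(z : 𝔞), D.R.coroot i⟫ := fun z => real_inner_comm _ _
    have hne : f.ker ≠ ⊤ := fun h => by
      have h1 : v ∈ f.ker := by rw [h]; trivial
      rw [LinearMap.mem_ker, hf] at h1
      have h2 := (D.inner_coroot_pos_iff (D.mem_sPos.1 hi).2.1 (v : 𝔞)).2 (hv i hi)
      exact h2.ne' h1
    have h0 := (volume : Measure D.aPrime).addHaar_submodule _ hne
    filter_upwards [measure_eq_zero_iff_ae_notMem.1 h0] with z hz h
    exact hz (by rw [SetLike.mem_coe, LinearMap.mem_ker, hf]; exact h)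
  filter_upwards [hfront, hwall] with z hz1 hz2 hz
  obtain ⟨hzK, hzpos⟩ := M.mem_two_smul_dominantPart.1 hz
  have hint : z ∈ interior ((M.level : ℝ)⁻¹ • convexHull ℝ (M.weights : Set D.aPrime)) := by
    by_contra hni
    exact hz1 ⟨subset_closure hzK, hni⟩
  obtain ⟨x, hx⟩ := exists_gradient_logSumExp_eq M.level_cast_pos M.weights_nonempty M.coeff_pos
    (hK.smooth.differentiable (by simp)) hint
  have hx' : D.grad M.admissiblePotential x = z := hx
  refine ⟨x, hK.mem_chamber_of_inner_grad_pos fun i hi => ?_, hx'⟩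
  rw [hx']
  exact lt_of_le_of_ne (hzpos i hi) (hz2 i hi).symm

lemma integrableOn_two_smul_dominantPart {F : Type*} [NormedAddCommGroup F] {f : D.aPrime → F}
    (hf : Continuous f) : IntegrableOn f ((2 : ℝ) • M.dominantPart) :=
  hf.continuousOn.integrableOn_compact M.isCompact_two_smul_dominantPart

/-- Full mass: the gradients of the potential on the chamber exhaust `2P₊` up to a null set, because
they lie in `2P₊` and `π₀ > 0` almost everywhere there. -/
lemma image_grad_ae_eq (hψ : D.IsKahlerPotential ψ) (hmass : M.HasFullMass ψ) :
    D.grad ψ '' D.chamber =ᵐ[volume] ((2 : ℝ) • M.dominantPart : Set D.aPrime) := by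
  have hK := M.isKahlerPotential_admissiblePotential
  obtain ⟨C, hC⟩ := hmass.current
  have hsub := M.image_grad_subset hψ hC
  have hsub0 := M.image_grad_subset hK (C := 0) (fun x => (add_zero _).ge)
  set S : Set D.aPrime := (2 : ℝ) • M.dominantPart with hS
  set p : D.aPrime → ℝ := fun z => D.piZero ((z : 𝔞) + D.twoRhoU) with hp
  have hpc : Continuous p := continuous_piZero.comp (by fun_prop)
  have hSm : MeasurableSet S := M.isCompact_two_smul_dominantPart.isClosed.measurableSet
  have hae0 : D.grad M.admissiblePotential '' D.chamber =ᵐ[volume] S := by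
    filter_upwards [M.ae_mem_image_grad_admissiblePotential] with z hz
    exact propext ⟨fun h => hsub0 h, hz⟩
  have hvol : ∫ z in D.grad ψ '' D.chamber, p z = ∫ z in S, p z := by
    rw [← hψ.metricVolume_eq, hmass.volume_eq, hK.metricVolume_eq]
    exact setIntegral_congr_set hae0
  have hppos : ∀ᵐ z : D.aPrime, z ∈ S → 0 < p z := by
    filter_upwards [M.ae_mem_image_grad_admissiblePotential] with z hz hzS
    obtain ⟨x, hx, rfl⟩ := hz hzS
    exact hK.piZero_shiftedGrad_pos hx
  have hm := hψ.measurableSet_image_grad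
  have hpS := M.integrableOn_two_smul_dominantPart hpc
  have hdiff : ∫ z in S \ D.grad ψ '' D.chamber, p z = 0 := by
    rw [setIntegral_sdiff hm hpS hsub, hvol, sub_self]
  have hdpos : ∀ᵐ z ∂(volume.restrict (S \ D.grad ψ '' D.chamber)), 0 < p z := by
    rw [ae_restrict_iff' (hSm.diff hm)]
    filter_upwards [hppos] with z hz h using hz h.1
  have hzero := (setIntegral_eq_zero_iff_of_nonneg_ae (hdpos.mono fun z h => h.le)
    (hpS.mono_set Set.sdiff_subset)).1 hdiff
  have hnull : volume (S \ D.grad ψ '' D.chamber) = 0 := by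
    rw [← Measure.restrict_eq_zero, ← ae_eq_bot, ← Filter.eventually_false_iff_eq_bot]
    filter_upwards [hzero, hdpos] with z h1 h2
    exact h2.ne' h1
  filter_upwards [measure_eq_zero_iff_ae_notMem.1 hnull] with z hz
  exact propext ⟨fun h => hsub h, fun h => by_contra fun h' => hz ⟨h, h'⟩⟩

end Compactification

end HorosymmetricDatum

/-! ### The soliton equation and the barycenter -/

lemma setIntegral_pos_of_isOpen {E : Type*} [TopologicalSpace E] [MeasurableSpace E]
    [OpensMeasurableSpace E] {μ : Measure E} [μ.IsOpenPosMeasure] {s : Set E} (hs : IsOpen s)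
    (hne : s.Nonempty) {f : E → ℝ} (hf : IntegrableOn f s μ) (hpos : ∀ x ∈ s, 0 < f x) :
    0 < ∫ x in s, f x ∂μ := by
  have hae : 0 ≤ᵐ[μ.restrict s] f := by
    filter_upwards [ae_restrict_mem hs.measurableSet] with x hx using (hpos x hx).le
  rw [setIntegral_pos_iff_support_of_nonneg_ae hae hf]
  have : Function.support f ∩ s = s := Set.inter_eq_right.2 fun x hx => (hpos x hx).ne'
  rw [this]
  exact hs.measure_pos μ hne

namespace HorosymmetricDatum.Compactification

variable {ι 𝔞 : Type*} [Fintype ι] [NormedAddCommGroup 𝔞] [InnerProductSpace ℝ 𝔞]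
  [FiniteDimensional ℝ 𝔞] [MeasurableSpace 𝔞] [BorelSpace 𝔞] {D : HorosymmetricDatum ι 𝔞}
  (M : D.Compactification) {X : D.aPrime} {ψ : D.aPrime → ℝ}

/-- The soliton equation turns the weight `e^{θ_X} π₀` on `2(P₊ + ρ_u)` into the weight `J₀ e^{-ψ}` on
the chamber. -/
lemma exists_setIntegral_dominantPart_eq (hψ : D.IsKahlerPotential ψ)
    (hsol : D.ReducedSolitonEquation X ψ) (hmass : M.HasFullMass ψ) :
    ∃ c : ℝ, 0 < c ∧ IntegrableOn (fun x => D.jZero x * Real.exp (-ψ x)) D.chamber ∧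
      (∀ h : D.aPrime → 𝔞, ∫ z in (2 : ℝ) • M.dominantPart,
        (Real.exp ⟪(X : 𝔞), (z : 𝔞) + D.twoRhoU⟫ * D.piZero ((z : 𝔞) + D.twoRhoU)) • h z =
        c • ∫ x in D.chamber, (D.jZero x * Real.exp (-ψ x)) • h (D.grad ψ x)) ∧
      (∫ z in (2 : ℝ) • M.dominantPart,
        Real.exp ⟪(X : 𝔞), (z : 𝔞) + D.twoRhoU⟫ * D.piZero ((z : 𝔞) + D.twoRhoU) =
        c * ∫ x in D.chamber, D.jZero x * Real.exp (-ψ x)) := by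
  obtain ⟨c, hc, hsol⟩ := hsol
  set w : D.aPrime → ℝ := fun z =>
    Real.exp ⟪(X : 𝔞), (z : 𝔞) + D.twoRhoU⟫ * D.piZero ((z : 𝔞) + D.twoRhoU) with hw
  -- `2ρ_u` may have a component along `X`, which contributes a constant factor.
  set c' := c * Real.exp ⟪(X : 𝔞), D.twoRhoU⟫ with hc'
  have hc'pos : 0 < c' := mul_pos hc (Real.exp_pos _)
  have hmeas := (isOpen_chamber (D := D)).measurableSet
  have hpt : ∀ x ∈ D.chamber, (D.hess ψ x).det * w (D.grad ψ x) =
      c' * (D.jZero x * Real.exp (-ψ x)) := fun x hx => by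
    have h1 := hsol x hx
    have h2 : Real.exp ⟪(X : 𝔞), (D.grad ψ x : 𝔞) + D.twoRhoU⟫ =
        Real.exp ⟪X, D.grad ψ x⟫ * Real.exp ⟪(X : 𝔞), D.twoRhoU⟫ := by
      rw [inner_add_right, Real.exp_add, Submodule.coe_inner]
    have h3 : Real.exp (-ψ x) = Real.exp (-ψ x - ⟪X, D.grad ψ x⟫) * Real.exp ⟪X, D.grad ψ x⟫ := by
      rw [← Real.exp_add, sub_add_cancel]
    change (D.hess ψ x).det * (Real.exp _ * D.piZero (D.shiftedGrad ψ x)) = _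
    rw [h2, h3, hc']
    linear_combination (Real.exp ⟪X, D.grad ψ x⟫ * Real.exp ⟪(X : 𝔞), D.twoRhoU⟫) * h1
  have hwc : Continuous w :=
    (Real.continuous_exp.comp (by fun_prop)).mul (continuous_piZero.comp (by fun_prop))
  have hae := M.image_grad_ae_eq hψ hmass
  have hint : IntegrableOn (fun x => D.jZero x * Real.exp (-ψ x)) D.chamber := by
    have h1 : IntegrableOn w (D.grad ψ '' D.chamber) :=
      (integrableOn_congr_set_ae hae).2 (M.integrableOn_two_smul_dominantPart hwc)
    rw [hψ.integrableOn_image_grad_iff] at h1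
    have h2 : IntegrableOn (fun x => c' * (D.jZero x * Real.exp (-ψ x))) D.chamber :=
      h1.congr_fun (fun x hx => hpt x hx) hmeas
    exact (integrable_const_mul_iff hc'pos.ne'.isUnit _).1 h2
  refine ⟨c', hc'pos, hint, fun h => ?_, ?_⟩
  · rw [← setIntegral_congr_set hae, hψ.setIntegral_image_grad, ← integral_smul]
    exact setIntegral_congr_fun hmeas fun x hx => by
      rw [smul_smul, smul_smul, ← hpt x hx]
  · rw [← setIntegral_congr_set hae, hψ.setIntegral_image_grad, ← integral_const_mul]
    exact setIntegral_congr_fun hmeas fun x hx => hpt x hx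

end HorosymmetricDatum.Compactification

theorem mainTheorem9 {ι 𝔞 : Type*} [Fintype ι] [NormedAddCommGroup 𝔞] [InnerProductSpace ℝ 𝔞]
    [FiniteDimensional ℝ 𝔞] [MeasurableSpace 𝔞] [BorelSpace 𝔞]
    (D : HorosymmetricDatum ι 𝔞) (M : D.Compactification)
    (X : D.aPrime) (ψ : D.aPrime → ℝ) (hψ : D.IsKahlerPotential ψ)
    (hsol : D.ReducedSolitonEquation X ψ) (hmass : M.HasFullMass ψ) :
    0 < M.weightedVolume X ∧ ∃ v ∈ D.Xi, M.barycenter X = D.twoRho + v := by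
  classical
  obtain ⟨c, hc, hint, hchange⟩ := M.exists_setIntegral_dominantPart_eq hψ hsol hmass
  obtain ⟨C, hC⟩ := hmass.current
  have hopen := HorosymmetricDatum.isOpen_chamber (D := D)
  have hne := D.chamber_nonempty
  obtain ⟨L, hL⟩ := (isCompact_smul_convexHull (M.level : ℝ) M.weights).isBounded.exists_norm_le
  have hgrad : ∀ x, ‖gradient ψ x‖ ≤ L := fun x => hL _ (M.grad_mem_of_le hψ hC x)
  have hJ : (fun x => D.jZero x * Real.exp (-ψ x)) =
      fun x => (∏ i ∈ D.sPos, Real.sinh ⟪D.restrictedRoot i, x⟫) * Real.exp (-ψ x) := by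
    simp only [HorosymmetricDatum.jZero_eq]
  obtain ⟨hcoeff, hgint, hparts⟩ := setIntegral_smul_gradient (μ := volume) (s := D.sPos)
    (a := D.restrictedRoot) hψ.smooth hgrad
    (by rwa [← HorosymmetricDatum.chamber_eq_openCone])
    (by rw [← HorosymmetricDatum.chamber_eq_openCone, ← hJ]; exact hint)
  simp only [← HorosymmetricDatum.chamber_eq_openCone, ← HorosymmetricDatum.jZero_eq]
    at hcoeff hgint hparts
  set m := ∫ x in D.chamber, D.jZero x * Real.exp (-ψ x) with hm
  set k : ι → ℝ := fun i =>
    ∫ x in D.chamber, sinhProdCoeff D.sPos D.restrictedRoot i x * Real.exp (-ψ x) with hk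
  have hmpos : 0 < m := setIntegral_pos_of_isOpen hopen hne hint fun x hx =>
    mul_pos (HorosymmetricDatum.jZero_pos hx) (Real.exp_pos _)
  -- `cosh > sinh` makes every coefficient larger than the total mass.
  have hkm : ∀ i ∈ D.sPos, m < k i := fun i hi => by
    rw [← sub_pos, hk, hm]
    simp only
    rw [← integral_sub (hcoeff i hi) hint]
    refine setIntegral_pos_of_isOpen hopen hne ((hcoeff i hi).sub hint) fun x hx => ?_
    rw [HorosymmetricDatum.chamber_eq_openCone] at hx
    have := sinhProd_lt_sinhProdCoeff hx hi
    rw [sinhProd_of_mem hx, ← HorosymmetricDatum.jZero_eq] at this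
    exact sub_pos.2 (mul_lt_mul_of_pos_right this (Real.exp_pos _))
  have hvol : M.weightedVolume X = c * m := hchange.2
  refine ⟨hvol ▸ mul_pos hc hmpos, ?_⟩
  have hnum : ∫ x in D.chamber, (D.jZero x * Real.exp (-ψ x)) • ((D.grad ψ x : 𝔞) + D.twoRhoU) =
      ∑ i ∈ D.sPos, k i • (D.restrictedRoot i : 𝔞) + m • D.twoRhoU := by
    have h1 : IntegrableOn (fun x => (D.jZero x * Real.exp (-ψ x)) • (D.grad ψ x : 𝔞))
        D.chamber := D.aPrime.subtypeL.integrable_comp hgint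
    have h2 : ∫ x in D.chamber, (D.jZero x * Real.exp (-ψ x)) • (D.grad ψ x : 𝔞) =
        ((∫ x in D.chamber, (D.jZero x * Real.exp (-ψ x)) • gradient ψ x : D.aPrime) : 𝔞) :=
      D.aPrime.subtypeL.integral_comp_comm hgint
    simp only [smul_add]
    rw [integral_add h1 (hint.smul_const _), h2, hparts, integral_smul_const, Submodule.coe_sum]
    rfl
  have hbar : M.barycenter X =
      ∑ i ∈ D.sPos, (m⁻¹ * k i) • (D.restrictedRoot i : 𝔞) + D.twoRhoU := by
    rw [HorosymmetricDatum.Compactification.barycenter, hvol,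
      hchange.1 fun z => (z : 𝔞) + D.twoRhoU, hnum, smul_smul, mul_inv, mul_assoc, mul_comm m⁻¹,
      ← mul_assoc, inv_mul_cancel₀ hc.ne', one_mul, smul_add, smul_smul,
      inv_mul_cancel₀ hmpos.ne', one_smul, Finset.smul_sum]
    simp only [smul_smul]
  obtain ⟨τ, hτ, hsum⟩ := D.exists_sum_smul_restrictedRoot_eq
  refine ⟨∑ i ∈ D.sPos, ((m⁻¹ * k i + m⁻¹ * k (τ i)) / 2 - 1) • D.R.root i, ?_, ?_⟩
  · refine sum_smul_mem_intrinsicInterior_hull D.sPos D.R.root fun i hi => ?_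
    have h : ∀ j ∈ D.sPos, 1 < m⁻¹ * k j := fun j hj => by
      rw [lt_inv_mul_iff₀ hmpos, mul_one]
      exact hkm j hj
    linarith [h i hi, h _ (hτ i hi)]
  · rw [hbar, hsum fun i => m⁻¹ * k i, HorosymmetricDatum.twoRho, HorosymmetricDatum.twoRhoU]
    simp only [sub_smul, one_smul, Finset.sum_sub_distrib]
    abel
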